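/- Identify $\mathbb R^2$ with $\mathbb C$ and write $(x_1,x_2)^\perp=(-x_2,x_1)$. Let $\Gamma$ be a $C^2$ Jordan arc (the image of an injective $C^2$ map $[0,1]\to\mathbb R^2$ with nowhere vanishing derivative) with endpoints $-1$ and $1$, whose intersection with the segment $[-1,1]$ is a finite union of segments and points. Put $\Pi=\mathbb R^2\setminus\Gamma$, and let $T:\Pi\to\{|z|>1\}$ be a biholomorphism. Let $\nu>0$, $\omega_0\in C_c^\infty(\Pi)$, $\gamma\in\mathbb R$, $\alpha=\gamma+\int\omega_0$. With $z^*=z/|z|^2$, set $$K(x,y)=\frac1{2\pi}DT^t(x)\Bigl(\frac{(T(x)-T(y))^\perp}{|T(x)-T(y)|^2}-\frac{(T(x)-T(y)^*)^\perp}{|T(x)-T(y)^*|^2}\Bigr),\qquad H(x)=\frac1{2\pi}DT^t(x)\frac{T(x)^\perp}{|T(x)|^2},$$ $$K[\omega_0](x)=\int_\Pi K(x,y)\,\omega_0(y)\,dy,\qquad u_0=K[\omega_0]+\alpha H,\qquad v(x)=\alpha\,\Phi\Bigl(\frac{|T(x)|-1}{\lambda}\Bigr)H(x),$$ where $\lambda\ge2$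 and $\Phi\in C^\infty(\mathbb R;[0,1])$ is non-decreasing with $\Phi(s)=0$ for $s\le1$ and $\Phi(s)=1$ for $s\ge2$. Let $\mathcal H_\Gamma$ and $\mathcal V_\Gamma$ be the closures, in $L^2(\Pi)$ and in $H^1(\Pi)$ respectively, of the space of divergence-free vector fields with components in $C_c^\infty(\Pi)$. A global weak solution of the Navier–Stokes equations on $\mathbb R^+\times\Pi$ with initial velocity $u_0$, where $u_0-v\in\mathcal H_\Gamma$, is a vector field $u$ such that $$u-v\in C([0,\infty);\mathcal H_\Gamma)\cap L^2_{\rm loc}([0,\infty);\mathcal V_\Gamma),$$ such that $$\int_0^\infty\!\!\int_\Pi\bigl(u\cdot\psi_t+[(u\cdot\nabla)\psi]\cdot u+\nu\,u\cdot\Delta\psi\bigr)\,dx\,dt=0$$ for every divergence-free vector field $\psi\in C_c^\infty((0,\infty)\times\Pi)$, such that $\operatorname{div}u=0$ in the sense of distributions, and such that $u(\cdot,t)\rightharpoonup u_0$ in the sense of distributions on $\Pi$ as $t\to0^+$. Then there is at most one such solution: if $u_1$ and $u_2$ are two global weak solutions with the initial velocity $u_0=K[\omega_0]+\alpha H$,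 then $u_1(\cdot,t)=u_2(\cdot,t)$ almost everywhere in $\Pi$ for every $t\ge0$. -/

import Mathlib

open MeasureTheory Set Filter Topology
open scoped ContDiff

noncomputable section

/-! The plane `ℝ²` is identified with `ℂ`, with its real inner product `inner ℝ` and Lebesgue
measure `volume`; `x₁ + i x₂` stands for `(x₁, x₂)`. -/

namespace ThinObstacle

/-- `γ`, restricted to `[0, 1]`, parametrizes a Jordan arc of class `C²`. -/
structure IsC2JordanArc (γ : ℝ → ℂ) : Prop where
  injOn : InjOn γ (Icc 0 1)
  contDiffOn : ContDiffOn ℝ 2 γ (Icc 0 1)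
  derivWithin_ne_zero : ∀ s ∈ Icc (0 : ℝ) 1, derivWithin γ (Icc 0 1) s ≠ 0

/-- The set of points of an arc parametrized by `[0, 1]`. -/
def arc (γ : ℝ → ℂ) : Set ℂ := γ '' Icc 0 1

/-- A finite union of segments and points (a point is a segment with equal endpoints). -/
def IsFiniteUnionOfSegments (A : Set ℂ) : Prop :=
  ∃ F : Set (ℂ × ℂ), F.Finite ∧ A = ⋃ p ∈ F, segment ℝ p.1 p.2

/-- `T` restricts to a biholomorphism of `A` onto `B`. -/
def IsBiholomorphism (T : ℂ → ℂ) (A B : Set ℂ) : Prop :=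
  DifferentiableOn ℂ T A ∧ BijOn T A B ∧ ∃ S : ℂ → ℂ, DifferentiableOn ℂ S B ∧ InvOn S T A B

/-- `f ∈ C_c^∞(Ω)`, for functions defined on the whole space (extended by zero). -/
structure IsTestFunction {E F : Type*} [NormedAddCommGroup E] [NormedSpace ℝ E]
    [NormedAddCommGroup F] [NormedSpace ℝ F] (Ω : Set E) (f : E → F) : Prop where
  contDiff : ContDiff ℝ ∞ f
  hasCompactSupport : HasCompactSupport f
  tsupport_subset : tsupport f ⊆ Ω

/-- The divergence `∂₁ φ₁ + ∂₂ φ₂` of a (differentiable) vector field on the plane. -/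
def divergence (φ : ℂ → ℂ) (x : ℂ) : ℝ :=
  (fderiv ℝ φ x 1).re + (fderiv ℝ φ x Complex.I).im

/-- The space `V(Ω)` of divergence-free vector fields with components in `C_c^∞(Ω)`. -/
def solenoidalTest (Ω : Set ℂ) : Set (ℂ → ℂ) :=
  {φ | IsTestFunction Ω φ ∧ ∀ x, divergence φ x = 0}

/-- The space `L²(Ω)` of square-integrable vector fields. -/
abbrev L2 (Ω : Set ℂ) : Type := Lp ℂ 2 (volume.restrict Ω)

/-- The space `𝓗(Ω)`: the closure of `V(Ω)` in `L²(Ω)`. -/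
def spaceH (Ω : Set ℂ) : Set (L2 Ω) :=
  closure {f | ∃ φ ∈ solenoidalTest Ω, f =ᵐ[volume.restrict Ω] φ}

/-- `g` is the weak derivative of `f` on `Ω` in the direction `e`. -/
def HasWeakDeriv (Ω : Set ℂ) (e : ℂ) (f g : L2 Ω) : Prop :=
  ∀ χ : ℂ → ℝ, IsTestFunction Ω χ →
    ∫ x in Ω, fderiv ℝ χ x e • f x = - ∫ x in Ω, χ x • g x

/-- The ambient Hilbert space `L²(Ω)³` of the triples `(f, ∂₁ f, ∂₂ f)`; its norm restricted to
such triples is the norm of `H¹(Ω)`. -/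
abbrev Jet (Ω : Set ℂ) : Type := PiLp 2 (fun _ : Fin 3 => L2 Ω)

/-- The Sobolev space `H¹(Ω)` of vector fields, a field `f` being recorded together with its weak
derivatives as the triple `(f, ∂₁ f, ∂₂ f)`. -/
def sobolevH1 (Ω : Set ℂ) : Set (Jet Ω) :=
  {F | HasWeakDeriv Ω 1 (F 0) (F 1) ∧ HasWeakDeriv Ω Complex.I (F 0) (F 2)}

/-- The space `𝓥(Ω)`: the closure of `V(Ω)` in `H¹(Ω)`. -/
def spaceV (Ω : Set ℂ) : Set (Jet Ω) :=
  sobolevH1 Ω ∩ closure {F | ∃ φ ∈ solenoidalTest Ω,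
    F 0 =ᵐ[volume.restrict Ω] φ ∧
    F 1 =ᵐ[volume.restrict Ω] (fun x => fderiv ℝ φ x 1) ∧
    F 2 =ᵐ[volume.restrict Ω] (fun x => fderiv ℝ φ x Complex.I)}

/-- The curve `w` in `L²(Ω)` belongs to `C([0,∞); 𝓗(Ω))`. -/
def IsContinuousInH (Ω : Set ℂ) (w : ℝ → L2 Ω) : Prop :=
  ContinuousOn w (Ici 0) ∧ ∀ t, 0 ≤ t → w t ∈ spaceH Ω

/-- The curve `w` in `L²(Ω)` belongs to `L²_loc([0,∞); 𝓥(Ω))`: it comes from a (Bochner) strongly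
measurable curve in `𝓥(Ω)` whose `H¹` norm is square-integrable on every `(0, τ]`. -/
def IsLocallySquareIntegrableInV (Ω : Set ℂ) (w : ℝ → L2 Ω) : Prop :=
  ∃ W : ℝ → Jet Ω,
    (∀ τ : ℝ, 0 < τ → MemLp W 2 (volume.restrict (Ioc 0 τ))) ∧
    ∀ᵐ t ∂(volume.restrict (Ioi (0 : ℝ))), W t ∈ spaceV Ω ∧ W t 0 = w t

/-- `u` is a global weak solution of the incompressible Navier–Stokes equations with viscosity `ν`
on `ℝ⁺ × Ω` with initial velocity `u₀`, relative to the fixed time-independent field `v` that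
carries the behaviour at infinity: `u t x` is the velocity at time `t ≥ 0` at the point `x ∈ Ω`. -/
structure IsWeakSolution (Ω : Set ℂ) (ν : ℝ) (v u₀ : ℂ → ℂ) (u : ℝ → ℂ → ℂ) : Prop where
  /-- `u₀ - v ∈ 𝓗(Ω)` -/
  initial_mem : ∃ w₀ ∈ spaceH Ω, w₀ =ᵐ[volume.restrict Ω] fun x => u₀ x - v x
  /-- `u - v ∈ C([0,∞); 𝓗(Ω)) ∩ L²_loc([0,∞); 𝓥(Ω))` -/
  regularity : ∃ w : ℝ → L2 Ω, IsContinuousInH Ω w ∧ IsLocallySquareIntegrableInV Ω w ∧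
    ∀ t, 0 ≤ t → w t =ᵐ[volume.restrict Ω] fun x => u t x - v x
  /-- the momentum equation, tested with divergence-free fields in `C_c^∞((0,∞) × Ω)` -/
  momentum : ∀ ψ : ℝ × ℂ → ℂ, IsTestFunction (Ioi 0 ×ˢ Ω) ψ →
    (∀ t x, divergence (fun y => ψ (t, y)) x = 0) →
    ∫ t in Ioi (0 : ℝ), ∫ x in Ω,
      (inner ℝ (u t x) (deriv (fun s => ψ (s, x)) t)
        + inner ℝ (fderiv ℝ (fun y => ψ (t, y)) x (u t x)) (u t x)
        + ν * inner ℝ (u t x) (Laplacian.laplacian (fun y => ψ (t, y)) x)) = 0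
  /-- `div u = 0` in the sense of distributions on `(0,∞) × Ω` -/
  divergence_free : ∀ χ : ℝ × ℂ → ℝ, IsTestFunction (Ioi 0 ×ˢ Ω) χ →
    ∫ t in Ioi (0 : ℝ), ∫ x in Ω, fderiv ℝ (fun y => χ (t, y)) x (u t x) = 0
  /-- `u(·, t) ⇀ u₀` in the sense of distributions on `Ω` as `t → 0⁺` -/
  initial : ∀ φ : ℂ → ℂ, IsTestFunction Ω φ →
    Tendsto (fun t => ∫ x in Ω, inner ℝ (u t x) (φ x)) (𝓝[>] 0)
      (𝓝 (∫ x in Ω, inner ℝ (u₀ x) (φ x)))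

/-- The rotation `(x₁, x₂)^⊥ = (-x₂, x₁)`. -/
def perp (z : ℂ) : ℂ := Complex.I * z

/-- `DT(x)ᵗ w`, with `DT(x)` the real Jacobian of `T` at `x`. -/
def jacobianTranspose (T : ℂ → ℂ) (x w : ℂ) : ℂ :=
  ContinuousLinearMap.adjoint (fderiv ℝ T x) w

/-- The vector `z / |z|²` (`z^*` is the image of `z` under inversion in the unit circle). -/
def inversion (z : ℂ) : ℂ := ((‖z‖ ^ 2)⁻¹ : ℝ) • z

/-- The harmonic field `H = (1/2π) DTᵗ (T^⊥ / |T|²)`. -/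
def harmonicField (T : ℂ → ℂ) (x : ℂ) : ℂ :=
  (1 / (2 * Real.pi) : ℝ) • jacobianTranspose T x (((‖T x‖ ^ 2)⁻¹ : ℝ) • perp (T x))

/-- The Biot–Savart kernel
`K(x,y) = (1/2π) DTᵗ(x) ((T x - T y)^⊥ / |T x - T y|² - (T x - (T y)^*)^⊥ / |T x - (T y)^*|²)`. -/
def biotSavartKernel (T : ℂ → ℂ) (x y : ℂ) : ℂ :=
  (1 / (2 * Real.pi) : ℝ) • jacobianTranspose T x
    (((‖T x - T y‖ ^ 2)⁻¹ : ℝ) • perp (T x - T y)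
      - ((‖T x - inversion (T y)‖ ^ 2)⁻¹ : ℝ) • perp (T x - inversion (T y)))

/-- `K[f](x) = ∫_Ω K(x,y) f(y) dy`. -/
def biotSavart (Ω : Set ℂ) (T : ℂ → ℂ) (f : ℂ → ℝ) (x : ℂ) : ℂ :=
  ∫ y in Ω, f y • biotSavartKernel T x y

/-- The profile of the cutoff: smooth, non-decreasing, with values in `[0,1]`, equal to `0` on
`(-∞, 1]` and to `1` on `[2, ∞)`. -/
structure IsCutoffProfile (Φ : ℝ → ℝ) : Prop where
  contDiff : ContDiff ℝ ∞ Φ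
  monotone : Monotone Φ
  mem_Icc : ∀ s, Φ s ∈ Icc (0 : ℝ) 1
  eq_one : ∀ s, 2 ≤ s → Φ s = 1
  eq_zero : ∀ s, s ≤ 1 → Φ s = 0

/-- The coefficient `α = circ + ∫ ω₀`, where `circ` is the circulation around the curve. -/
def alpha (circ : ℝ) (ω₀ : ℂ → ℝ) : ℝ := circ + ∫ x, ω₀ x

/-- The field `v = α H Φ((|T| - 1) / lam)`. -/
def backgroundField (T : ℂ → ℂ) (Φ : ℝ → ℝ) (lam α : ℝ) (x : ℂ) : ℂ :=
  (α * Φ ((‖T x‖ - 1) / lam)) • harmonicField T x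

/-- The initial velocity `u₀ = K[ω₀] + α H`. -/
def initialVelocity (Ω : Set ℂ) (T : ℂ → ℂ) (ω₀ : ℂ → ℝ) (α : ℝ) (x : ℂ) : ℂ :=
  biotSavart Ω T ω₀ x + α • harmonicField T x

end ThinObstacle

end

/-! The proof is the two-dimensional Lions–Prodi uniqueness argument, run relative to a background
field `v` of which only boundedness is needed. Put `w = u₁ - u₂`; the field `v` cancels, so `w` is a
difference of two curves in `C([0,∞); 𝓗) ∩ L²_loc([0,∞); 𝓥)`. Testing the two equations with
solenoidal fields makes the pressure disappear and gives `∂ₜ w = p` weakly. Here `p` is a triple in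
`L²(Ω)³` paired with the jets `(φ, ∂₁φ, ∂₂φ)`, and it collects the viscous term `-ν ∇w` and the flux
`w ⊗ u₁ + u₂ ⊗ w = u₁ ⊗ u₁ - u₂ ⊗ u₂` (`inner_sub_eq_inner_integral_forcing`,
`momentumFlux_sub_eq_inner_forcing`).

Ladyzhenskaya's inequality `‖f‖₄² ≤ C ‖f‖₂ ‖∇f‖₂` holds on `𝓥` with a constant that ignores the
geometry of `Ω`, since test fields extend by zero (`exists_embedding_L4`). As `w₁ = u₁ - v` and `w₂
= u₂ - v` are bounded in `L²` on bounded times, they lie in `L⁴` of space-time there, and so `p` is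
square integrable in time with values in `L²(Ω)³` (`memLp_forcing`). By density `w` itself may then
serve as test field, and `‖w(t)‖² = 2 ∫₀ᵗ ⟨p, w⟩` (`norm_sq_eq_two_mul_integral_inner`).

The whole flux is estimated, without using the cancellation `⟨(u₂·∇)w, w⟩ = 0`; thus no derivative
of `v` occurs. Young's inequality absorbs the gradients into the viscosity and leaves a multiple of
`‖w‖²` whose coefficient, of order `(‖w₁‖₄ + ‖w₂‖₄)⁴ + ‖v‖∞²`, is locally integrable in time
(`two_mul_inner_forcing_le`, `integrableOn_energyRate`). Grönwall's lemma with an integrable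
coefficient gives `w = 0` (`eq_zero_of_le_integral_mul`).

What is left is that `v` is bounded (`memLp_top_backgroundField`). The cutoff removes a
neighbourhood of the arc, and away from it `|H| ≤ |T'| / (2π|T|)`, so a bound on the logarithmic
derivative of `T` suffices (`IsBiholomorphism.exists_norm_deriv_le`). At infinity it follows from
the holomorphic extension of `1 / T(1/z)` across `0`, elsewhere from compactness. -/

namespace ThinObstacle

/-! ### The du Bois-Reymond and Grönwall lemmas on the half-line. -/

section RealAnalysis

/-- Smooth approximation of the indicator of `[s, t]`, as the primitive of two mollifiers. -/
theorem exists_test_deriv_eq_sub_bump {s t : ℝ} (hst : s < t) (b : ContDiffBump (0 : ℝ))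
    (hb : b.rOut < s) :
    ∃ θ : ℝ → ℝ, IsTestFunction (Ioi 0) θ ∧
      ∀ x, HasDerivAt θ (b.normed volume (s - x) - b.normed volume (t - x)) x := by
  set ρ := b.normed volume with hρ
  set d : ℝ → ℝ := fun x => ρ (s - x) - ρ (t - x) with hd
  have hρc : ContDiff ℝ ∞ ρ := b.contDiff_normed
  have hdc : ContDiff ℝ ∞ d :=
    (hρc.comp (contDiff_const.sub contDiff_id)).sub (hρc.comp (contDiff_const.sub contDiff_id))
  have hρ0 : ∀ y, b.rOut ≤ |y| → ρ y = 0 := by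
    intro y hy
    have : y ∉ Function.support ρ := by
      rw [hρ, b.support_normed_eq]
      simpa using hy
    simpa using this
  set θ : ℝ → ℝ := fun r => ∫ x in (0 : ℝ)..r, d x with hθ
  have hder : ∀ x, HasDerivAt θ (d x) x := fun x =>
    intervalIntegral.integral_hasDerivAt_right (hdc.continuous.intervalIntegrable _ _)
      hdc.continuous.stronglyMeasurable.stronglyMeasurableAtFilter hdc.continuous.continuousAt
  have hbp := b.rOut_pos
  have hleft : ∀ r ≤ s - b.rOut, θ r = 0 := by
    intro r hr
    apply intervalIntegral.integral_zero_ae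
    refine Eventually.of_forall fun x hx => ?_
    have hx' : x ≤ s - b.rOut := by
      rcases le_total 0 r with h | h
      · rw [uIoc_of_le h] at hx; exact hx.2.trans hr
      · rw [uIoc_of_ge h] at hx; linarith [hx.2]
    have h1 : ρ (s - x) = 0 := hρ0 _ (by rw [abs_of_nonneg] <;> linarith)
    have h2 : ρ (t - x) = 0 := hρ0 _ (by rw [abs_of_nonneg] <;> linarith)
    simp [hd, h1, h2]
  -- Both bumps then lie inside `(0, r]`, thanks to `b.rOut < s`, and their equal masses cancel.
  have hright : ∀ r, t + b.rOut ≤ r → θ r = 0 := by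
    intro r hr
    have h1 : ∀ x ∉ Ioc 0 r, d x = 0 := by
      intro x hx
      rw [mem_Ioc, not_and_or, not_lt, not_le] at hx
      rcases hx with hx | hx
      · have h1 : ρ (s - x) = 0 := hρ0 _ (by rw [abs_of_nonneg] <;> linarith)
        have h2 : ρ (t - x) = 0 := hρ0 _ (by rw [abs_of_nonneg] <;> linarith)
        simp [hd, h1, h2]
      · have h1 : ρ (s - x) = 0 := hρ0 _ (by rw [abs_of_nonpos] <;> linarith)
        have h2 : ρ (t - x) = 0 := hρ0 _ (by rw [abs_of_nonpos] <;> linarith)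
        simp [hd, h1, h2]
    have hr0 : 0 ≤ r := by linarith
    have hint : Integrable ρ := b.integrable_normed
    rw [hθ]
    simp only
    rw [intervalIntegral.integral_of_le hr0, setIntegral_eq_integral_of_forall_compl_eq_zero h1]
    rw [hd, integral_sub (hint.comp_sub_left s) (hint.comp_sub_left t),
      integral_sub_left_eq_self ρ volume s, integral_sub_left_eq_self ρ volume t, sub_self]
  have hsupp : Function.support θ ⊆ Icc (s - b.rOut) (t + b.rOut) := by
    intro r hr
    by_contra h
    rw [mem_Icc, not_and_or, not_le, not_le] at h
    rcases h with h | h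
    · exact hr (hleft r h.le)
    · exact hr (hright r h.le)
  have htsupp : tsupport θ ⊆ Icc (s - b.rOut) (t + b.rOut) := closure_minimal hsupp isClosed_Icc
  refine ⟨θ, ⟨?_, ?_, ?_⟩, hder⟩
  · rw [contDiff_infty_iff_deriv]
    refine ⟨fun x => (hder x).differentiableAt, ?_⟩
    have : deriv θ = d := funext fun x => (hder x).deriv
    rw [this]; exact hdc
  · exact HasCompactSupport.of_support_subset_isCompact isCompact_Icc hsupp
  · intro x hx
    have := (htsupp hx).1
    simp only [mem_Ioi]; linarith

/-- The test function whose derivative is a bump at `s` minus a bump at `t` equates the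
mollifications of `k` at the two points; then the bumps shrink. -/
theorem eq_of_integral_deriv_mul_eq_zero {k : ℝ → ℝ} (hk : Continuous k)
    (h : ∀ θ : ℝ → ℝ, IsTestFunction (Ioi 0) θ → ∫ t, deriv θ t * k t = 0)
    {s t : ℝ} (hs : 0 < s) (hst : s < t) : k s = k t := by
  let b : ℕ → ContDiffBump (0 : ℝ) := fun n =>
    ⟨(1 / ((n : ℝ) + 1)) / 2, 1 / ((n : ℝ) + 1), by positivity, half_lt_self (by positivity)⟩
  have hb : Tendsto (fun n => (b n).rOut) atTop (𝓝 0) :=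
    tendsto_one_div_add_atTop_nhds_zero_nat
  have hs' := ContDiffBump.convolution_tendsto_right_of_continuous (μ := volume) hb hk s
  have ht' := ContDiffBump.convolution_tendsto_right_of_continuous (μ := volume) hb hk t
  have hconv : ∀ n x, (convolution ((b n).normed volume) k (ContinuousLinearMap.lsmul ℝ ℝ) volume) x
      = ∫ r, (b n).normed volume (x - r) * k r := by
    intro n x
    rw [← integral_sub_left_eq_self (fun r => (b n).normed volume (x - r) * k r) volume x]
    simp [convolution]
  have heq : ∀ᶠ n in atTop,
      (convolution ((b n).normed volume) k (ContinuousLinearMap.lsmul ℝ ℝ) volume) s =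
      (convolution ((b n).normed volume) k (ContinuousLinearMap.lsmul ℝ ℝ) volume) t := by
    filter_upwards [hb.eventually_lt_const hs] with n hn
    obtain ⟨θ, hθ, hder⟩ := exists_test_deriv_eq_sub_bump hst (b n) hn
    have h0 := h θ hθ
    have hint : ∀ x, Integrable fun r => (b n).normed volume (x - r) * k r := by
      intro x
      have hc : Continuous fun r => (b n).normed volume (x - r) :=
        (b n).continuous_normed.comp (continuous_const.sub continuous_id)
      refine (hc.mul hk).integrable_of_hasCompactSupport (HasCompactSupport.mul_right ?_)
      exact (b n).hasCompactSupport_normed.comp_homeomorph (Homeomorph.subLeft x)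
    simp only [fun x => (hder x).deriv, sub_mul] at h0
    rw [integral_sub (hint s) (hint t)] at h0
    rw [hconv, hconv]; linarith
  exact tendsto_nhds_unique hs' (ht'.congr' (heq.mono fun n hn => hn.symm))

theorem IsTestFunction.deriv_eq_zero_of_notMem {θ : ℝ → ℝ} {Ω : Set ℝ} (hθ : IsTestFunction Ω θ)
    {t : ℝ} (ht : t ∉ Ω) : θ t = 0 ∧ deriv θ t = 0 :=
  ⟨image_eq_zero_of_notMem_tsupport fun h => ht (hθ.tsupport_subset h),
    by
      by_contra h
      exact ht (hθ.tsupport_subset (support_deriv_subset (𝕜 := ℝ) (Function.mem_support.2 h)))⟩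

/-- A du Bois-Reymond lemma: if `f' = G` weakly on `(0, ∞)` then `f` is a primitive of `G`. -/
theorem sub_eq_integral_of_weak_deriv {f G : ℝ → ℝ} (hf : ContinuousOn f (Ici 0))
    (hG : ContinuousOn G (Ici 0))
    (h : ∀ θ : ℝ → ℝ, IsTestFunction (Ioi 0) θ →
      ∫ t in Ioi (0 : ℝ), (deriv θ t * f t + θ t * G t) = 0)
    {t : ℝ} (ht : 0 ≤ t) : f t - f 0 = ∫ r in (0 : ℝ)..t, G r := by
  -- Constant continuation to negative times gives continuous functions on the line, and test
  -- functions supported in `(0, ∞)` do not see the change.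
  set f' : ℝ → ℝ := fun t => f (max t 0) with hf'
  set G' : ℝ → ℝ := fun t => G (max t 0) with hG'
  have hfc : Continuous f' := hf.comp_continuous (by fun_prop) fun t => mem_Ici.2 (le_max_right _ _)
  have hGc : Continuous G' := hG.comp_continuous (by fun_prop) fun t => mem_Ici.2 (le_max_right _ _)
  set F : ℝ → ℝ := fun t => ∫ r in (0 : ℝ)..t, G' r with hF
  have hFder : ∀ x, HasDerivAt F (G' x) x := fun x =>
    intervalIntegral.integral_hasDerivAt_right (hGc.intervalIntegrable _ _)
      hGc.stronglyMeasurable.stronglyMeasurableAtFilter hGc.continuousAt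
  have hFc : Continuous F := continuous_iff_continuousAt.2 fun x => (hFder x).continuousAt
  have key : ∀ θ : ℝ → ℝ, IsTestFunction (Ioi 0) θ → ∫ t, deriv θ t * (f' t - F t) = 0 := by
    intro θ hθ
    have hd : Continuous (deriv θ) := hθ.contDiff.continuous_deriv (by simp)
    have hds : HasCompactSupport (deriv θ) := hθ.hasCompactSupport.deriv
    have i1 : Integrable (fun t => deriv θ t * f' t) :=
      (hd.mul hfc).integrable_of_hasCompactSupport hds.mul_right
    have i2 : Integrable (fun t => deriv θ t * F t) :=
      (hd.mul hFc).integrable_of_hasCompactSupport hds.mul_right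
    have i3 : Integrable (fun t => θ t * G' t) :=
      (hθ.contDiff.continuous.mul hGc).integrable_of_hasCompactSupport hθ.hasCompactSupport.mul_right
    have i4 : Integrable (fun t => θ t * F t) :=
      (hθ.contDiff.continuous.mul hFc).integrable_of_hasCompactSupport hθ.hasCompactSupport.mul_right
    have h1 := integral_mul_deriv_eq_deriv_mul_of_integrable (u := θ) (v := F) (u' := deriv θ)
      (v' := G') (fun x _ => (hθ.contDiff.differentiable (by simp) x).hasDerivAt)
      (fun x _ => hFder x) i3 i2 i4
    have h2 : ∫ t, (deriv θ t * f' t + θ t * G' t) = 0 := by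
      rw [← h θ hθ, ← setIntegral_eq_integral_of_forall_compl_eq_zero (s := Ioi 0)]
      · refine setIntegral_congr_fun measurableSet_Ioi fun t ht => ?_
        have : max t 0 = t := max_eq_left (le_of_lt ht)
        simp only [hf', hG', this]
      · intro t ht
        obtain ⟨h1, h2⟩ := hθ.deriv_eq_zero_of_notMem ht
        simp [h1, h2]
    rw [integral_add i1 i3] at h2
    simp only [mul_sub]
    rw [integral_sub i1 i2]
    linarith
  have hconst : ∀ t, 0 < t → f' 0 - F 0 = f' t - F t := by
    intro t ht
    have h1 : Tendsto (fun s => f' s - F s) (𝓝[>] 0) (𝓝 (f' 0 - F 0)) :=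
      ((hfc.sub hFc).tendsto 0).mono_left nhdsWithin_le_nhds
    have h2 : ∀ᶠ s in 𝓝[>] (0 : ℝ), f' s - F s = f' t - F t := by
      filter_upwards [Ioo_mem_nhdsGT ht] with s hs
      exact eq_of_integral_deriv_mul_eq_zero (hfc.sub hFc) key hs.1 hs.2
    exact tendsto_nhds_unique (h1.congr' h2) tendsto_const_nhds
  rcases ht.eq_or_lt with rfl | ht
  · simp
  have h3 := hconst t ht
  have h4 : F t = ∫ r in (0 : ℝ)..t, G r := by
    refine intervalIntegral.integral_congr fun r hr => ?_
    rw [uIcc_of_le ht.le] at hr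
    simp [hG', max_eq_left hr.1]
  have h5 : F 0 = 0 := by simp [hF]
  simp only [hf', max_self, max_eq_left ht.le] at h3
  linarith

/-- Grönwall's inequality with an integrable coefficient, for zero initial data. -/
theorem eq_zero_of_le_integral_mul {E K : ℝ → ℝ} {τ : ℝ}
    (hE : ContinuousOn E (Icc 0 τ)) (hE0 : ∀ t ∈ Icc 0 τ, 0 ≤ E t)
    (hK : IntegrableOn K (Icc 0 τ)) (hK0 : ∀ t, 0 ≤ K t)
    (h : ∀ t ∈ Icc 0 τ, E t ≤ ∫ s in (0 : ℝ)..t, K s * E s) :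
    ∀ t ∈ Icc 0 τ, E t = 0 := by
  intro t₀ ht₀
  have hτ : 0 ≤ τ := ht₀.1.trans ht₀.2
  have hKE : IntegrableOn (fun s => K s * E s) (Icc 0 τ) :=
    hK.mul_continuousOn hE isCompact_Icc
  have hii : ∀ a ∈ Icc 0 τ, ∀ b ∈ Icc 0 τ, IntervalIntegrable (fun s => K s * E s) volume a b :=
    fun a ha b hb => (hKE.mono_set (uIcc_subset_Icc ha hb)).intervalIntegrable
  have hiK : ∀ a ∈ Icc 0 τ, ∀ b ∈ Icc 0 τ, IntervalIntegrable K volume a b :=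
    fun a ha b hb => (hK.mono_set (uIcc_subset_Icc ha hb)).intervalIntegrable
  set Q : ℝ → ℝ := fun t => ∫ s in (0 : ℝ)..t, K s * E s with hQ
  have h00 : (0 : ℝ) ∈ Icc 0 τ := ⟨le_rfl, hτ⟩
  have hQc : ContinuousOn Q (Icc 0 τ) := by
    have := intervalIntegral.continuousOn_primitive_interval (μ := volume)
      (f := fun s => K s * E s) (a := 0) (b := τ) (by rwa [uIcc_of_le hτ])
    rwa [uIcc_of_le hτ] at this
  have hmono : ∀ a ∈ Icc 0 τ, ∀ b ∈ Icc 0 τ, a ≤ b → Q a ≤ Q b := by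
    intro a ha b hb hab
    have h1 : Q a + ∫ s in a..b, K s * E s = Q b :=
      intervalIntegral.integral_add_adjacent_intervals (hii 0 h00 a ha) (hii a ha b hb)
    have h2 : 0 ≤ ∫ s in a..b, K s * E s :=
      intervalIntegral.integral_nonneg hab fun s hs =>
        mul_nonneg (hK0 s) (hE0 s ⟨ha.1.trans hs.1, hs.2.trans hb.2⟩)
    linarith
  have hQ0 : Q 0 = 0 := by simp [hQ]
  -- Continuous induction replaces the exponential integrating factor, as `K` is merely integrable.
  -- Beyond a point where `Q ≤ 0`, take a step on which `K` has mass below `1/2`: the maximum `E m`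
  -- there satisfies `E m ≤ Q m ≤ E m / 2`, so it vanishes and `Q` stays nonpositive.
  have main : Icc 0 τ ⊆ {t | Q t ≤ 0} := by
    refine IsClosed.Icc_subset_of_forall_exists_gt ?_ (by simp [hQ0]) ?_
    · rw [inter_comm]
      exact hQc.preimage_isClosed_of_isClosed isClosed_Icc isClosed_Iic
    · rintro x ⟨hx, hx0, hxτ⟩ y hy
      have hxI : x ∈ Icc 0 τ := ⟨hx0, hxτ.le⟩
      have hPc : ContinuousOn (fun z => ∫ s in x..z, K s) (Icc x τ) := by
        have := intervalIntegral.continuousOn_primitive_interval (μ := volume)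
          (f := K) (a := x) (b := τ)
          (by rw [uIcc_of_le hxτ.le]; exact hK.mono_set (Icc_subset_Icc_left hx0))
        rwa [uIcc_of_le hxτ.le] at this
      have hlim : ∀ᶠ z in 𝓝[>] x, ∫ s in x..z, K s < 1 / 2 := by
        have h1 := (hPc x ⟨le_rfl, hxτ.le⟩).tendsto
        simp only [intervalIntegral.integral_same] at h1
        have h2 := h1.eventually_lt_const (show (0 : ℝ) < 1 / 2 by norm_num)
        exact (nhdsWithin_le_of_mem (mem_of_superset (Ioo_mem_nhdsGT hxτ) Ioo_subset_Icc_self)) h2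
      have hlt : ∀ᶠ z in 𝓝[>] x, z ∈ Ioo x (min y τ) :=
        Ioo_mem_nhdsGT (lt_min hy hxτ)
      obtain ⟨z, hz1, hz2⟩ := (hlim.and hlt).exists
      have hzτ : z ≤ τ := (hz2.2.trans_le (min_le_right _ _)).le
      have hzy : z ≤ y := (hz2.2.trans_le (min_le_left _ _)).le
      have hzI : z ∈ Icc 0 τ := ⟨hx0.trans hz2.1.le, hzτ⟩
      refine ⟨z, ?_, hz2.1, hzy⟩
      obtain ⟨m, hm, hmax⟩ := isCompact_Icc.exists_isMaxOn (nonempty_Icc.2 hz2.1.le)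
        (hE.mono (Icc_subset_Icc hx0 hzτ))
      have hmI : m ∈ Icc 0 τ := ⟨hx0.trans hm.1, hm.2.trans hzτ⟩
      have hsub : ∀ r ∈ Icc x z, Q r ≤ E m / 2 := by
        intro r hr
        have hrI : r ∈ Icc 0 τ := ⟨hx0.trans hr.1, hr.2.trans hzτ⟩
        have h1 : Q x + ∫ s in x..r, K s * E s = Q r :=
          intervalIntegral.integral_add_adjacent_intervals (hii 0 h00 x hxI) (hii x hxI r hrI)
        have h2 : ∫ s in x..r, K s * E s ≤ ∫ s in x..r, K s * E m := by
          refine intervalIntegral.integral_mono_on hr.1 (hii x hxI r hrI)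
            ((hiK x hxI r hrI).mul_const _) fun s hs => ?_
          exact mul_le_mul_of_nonneg_left (hmax ⟨hs.1, hs.2.trans hr.2⟩) (hK0 s)
        have h3 : ∫ s in x..r, K s ≤ 1 / 2 := by
          have : (∫ s in x..r, K s) + ∫ s in r..z, K s = ∫ s in x..z, K s :=
            intervalIntegral.integral_add_adjacent_intervals (hiK x hxI r hrI) (hiK r hrI z hzI)
          have : 0 ≤ ∫ s in r..z, K s := intervalIntegral.integral_nonneg hr.2 fun s _ => hK0 s
          linarith
        rw [intervalIntegral.integral_mul_const] at h2
        have h4 : (∫ s in x..r, K s) * E m ≤ 1 / 2 * E m :=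
          mul_le_mul_of_nonneg_right h3 (hE0 m hmI)
        have hx' : Q x ≤ 0 := hx
        linarith
      have h5 := (h m hmI).trans (hsub m hm)
      have h6 := hsub z ⟨hz2.1.le, le_rfl⟩
      have h7 := hE0 m hmI
      change Q z ≤ 0
      linarith
  have h1 : E t₀ ≤ Q t₀ := h t₀ ht₀
  have h2 : Q t₀ ≤ 0 := main ht₀
  exact le_antisymm (h1.trans h2) (hE0 t₀ ht₀)

end RealAnalysis

/-! ### The energy identity for curves with a square-integrable weak derivative. -/

section Energy

variable {X : Type*} [NormedAddCommGroup X]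

/-- The translate `s ↦ f (s + ρ)` of a square-integrable curve. -/
noncomputable def translate (f : Lp X 2 (volume : Measure ℝ)) (ρ : ℝ) : Lp X 2 (volume : Measure ℝ) :=
  Lp.compMeasurePreserving (fun s => s + ρ) (measurePreserving_add_right volume ρ) f

theorem continuous_translate (f : Lp X 2 (volume : Measure ℝ)) : Continuous (translate f) := by
  let g : ℝ → C(ℝ, ℝ) := fun ρ => ⟨fun s => s + ρ, by fun_prop⟩
  have hg : Continuous g := by
    refine ContinuousMap.continuous_of_continuous_uncurry _ ?_
    change Continuous fun p : ℝ × ℝ => p.2 + p.1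
    fun_prop
  exact (continuous_const (y := f)).compMeasurePreservingLp hg
    (fun ρ => measurePreserving_add_right volume ρ) (by simp)

theorem coeFn_translate (f : Lp X 2 (volume : Measure ℝ)) (ρ : ℝ) :
    translate f ρ =ᵐ[volume] fun s => f (s + ρ) :=
  Lp.coeFn_compMeasurePreserving f (measurePreserving_add_right volume ρ)

variable [InnerProductSpace ℝ X]

/-- The integral is an inner product in `L²(0, t)` of restricted translates, and translation is
strongly continuous on `L²`. This replaces mollification in time in the energy identity. -/
theorem continuous_inner_translate (f g : Lp X 2 (volume : Measure ℝ)) (t : ℝ) :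
    Continuous fun p : ℝ × ℝ =>
      ∫ s in Ioc 0 t, (inner ℝ (f (s + p.1)) (g s + g (s + p.2)) : ℝ) := by
  let R := LpToLpRestrictCLM ℝ X ℝ volume 2 (Ioc 0 t)
  have h : (fun p : ℝ × ℝ => ∫ s in Ioc 0 t, (inner ℝ (f (s + p.1)) (g s + g (s + p.2)) : ℝ))
      = fun p => inner ℝ (R (translate f p.1)) (R (g + translate g p.2)) := by
    funext p
    rw [L2.inner_def]
    refine integral_congr_ae ?_
    filter_upwards [LpToLpRestrictCLM_coeFn ℝ (Ioc 0 t) (translate f p.1),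
      LpToLpRestrictCLM_coeFn ℝ (Ioc 0 t) (g + translate g p.2),
      ae_restrict_of_ae (coeFn_translate f p.1), ae_restrict_of_ae (coeFn_translate g p.2),
      ae_restrict_of_ae (Lp.coeFn_add g (translate g p.2))] with s h1 h2 h3 h4 h5
    rw [h1, h2, h3, h5, Pi.add_apply, h4]
  rw [h]
  exact (R.continuous.comp ((continuous_translate f).comp continuous_fst)).inner
    (R.continuous.comp (continuous_const.add ((continuous_translate g).comp continuous_snd)))

/-- This justifies Fubini in the energy identity. The integrand is dominated by `‖f (s + ρ)‖² + ‖g s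
+ g (s + δ)‖²`, and the first term has integral over `s` at most `‖f‖²`, uniformly in `ρ`. -/
theorem integrable_inner_translate (f g : Lp X 2 (volume : Measure ℝ)) (t δ : ℝ) :
    Integrable (Function.uncurry fun s ρ : ℝ => (inner ℝ (f (s + ρ)) (g s + g (s + δ)) : ℝ))
      ((volume.restrict (Ioc 0 t)).prod (volume.restrict (Ioc 0 δ))) := by
  set μ := (volume.restrict (Ioc (0 : ℝ) t)).prod (volume.restrict (Ioc (0 : ℝ) δ)) with hμ
  set Q : ℝ → X := fun s => g s + g (s + δ) with hQ
  have hgm := Lp.memLp g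
  have hQm : MemLp Q 2 volume :=
    hgm.add (hgm.comp_measurePreserving (measurePreserving_add_right volume δ))
  have hqmp : Measure.QuasiMeasurePreserving (fun p : ℝ × ℝ => p.1 + p.2) μ volume := by
    have h0 : μ ≪ volume.prod volume :=
      Measure.AbsolutelyContinuous.prod Measure.restrict_le_self.absolutelyContinuous
        Measure.restrict_le_self.absolutelyContinuous
    exact (quasiMeasurePreserving_add (volume : Measure ℝ) volume).mono_left h0
  have hf1 : AEStronglyMeasurable (fun p : ℝ × ℝ => f (p.1 + p.2)) μ :=
    (Lp.aestronglyMeasurable f).comp_quasiMeasurePreserving hqmp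
  have hQ1 : AEStronglyMeasurable (fun p : ℝ × ℝ => Q p.1) μ :=
    hQm.1.restrict.comp_fst
  have hf2 : Integrable (fun s => ‖f s‖ ^ 2) := (Lp.memLp f).integrable_norm_pow (by norm_num)
  have hQ2 : Integrable (fun s => ‖Q s‖ ^ 2) := hQm.integrable_norm_pow (by norm_num)
  have hdom1 : Integrable (fun p : ℝ × ℝ => ‖f (p.1 + p.2)‖ ^ 2) μ := by
    have hm : AEStronglyMeasurable (fun p : ℝ × ℝ => ‖f (p.1 + p.2)‖ ^ 2) μ := hf1.norm.pow 2
    refine (integrable_prod_iff' hm).2 ⟨?_, ?_⟩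
    · exact Eventually.of_forall fun ρ => (hf2.comp_add_right ρ).restrict
    · have hb : Integrable (fun _ : ℝ => ∫ s, ‖f s‖ ^ 2) (volume.restrict (Ioc (0 : ℝ) δ)) :=
        integrable_const _
      refine hb.mono' hm.norm.prod_swap.integral_prod_right' ?_
      refine Eventually.of_forall fun ρ => ?_
      rw [Real.norm_of_nonneg (integral_nonneg fun _ => norm_nonneg _)]
      simp only [Real.norm_eq_abs, abs_pow, abs_norm]
      rw [← integral_add_right_eq_self (fun s => ‖f s‖ ^ 2) ρ]
      exact setIntegral_le_integral (hf2.comp_add_right ρ)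
        (Eventually.of_forall fun _ => by positivity)
  have hdom2 : Integrable (fun p : ℝ × ℝ => ‖Q p.1‖ ^ 2) μ :=
    hQ2.restrict.comp_fst _
  refine (hdom1.add hdom2).mono' (hf1.inner hQ1) (Eventually.of_forall fun p => ?_)
  simp only [Function.uncurry, Pi.add_apply]
  refine (norm_inner_le_norm _ _).trans ?_
  change _ * ‖Q p.1‖ ≤ _
  nlinarith [sq_nonneg (‖f (p.1 + p.2)‖ - ‖Q p.1‖), sq_nonneg ‖f (p.1 + p.2)‖, sq_nonneg ‖Q p.1‖]

theorem norm_setIntegral_sub_const_le {k : ℝ → ℝ} {a δ c ε : ℝ} (hδ : 0 ≤ δ)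
    (hk : IntervalIntegrable k volume a (a + δ)) (h : ∀ x ∈ Icc a (a + δ), |k x - c| ≤ ε) :
    |(∫ x in a..(a + δ), k x) - δ * c| ≤ ε * δ := by
  have h1 : (∫ x in a..(a + δ), k x) - δ * c = ∫ x in a..(a + δ), (k x - c) := by
    rw [intervalIntegral.integral_sub hk intervalIntegrable_const]
    simp
  rw [h1, ← Real.norm_eq_abs]
  refine (intervalIntegral.norm_integral_le_of_norm_le_const (C := ε) fun x hx => ?_).trans ?_
  · rw [uIoc_of_le (by linarith)] at hx
    exact h x ⟨hx.1.le, hx.2⟩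
  · rw [add_sub_cancel_left, abs_of_nonneg hδ]

variable {H : Type*} [NormedAddCommGroup H] [InnerProductSpace ℝ H] [CompleteSpace X]

/-- The energy identity: if `w' = p` in the weak sense that `w` is tested against its own
values, a value `w s` being represented by `q s`, then `d/dt ‖w‖² = 2 ⟨p, q⟩`. -/
theorem norm_sq_eq_two_mul_integral_inner {w : ℝ → H} {p q : ℝ → X}
    (hw : ContinuousOn w (Ici 0)) (hw0 : w 0 = 0)
    (hp : ∀ τ, 0 < τ → MemLp p 2 (volume.restrict (Ioc 0 τ)))
    (hq : ∀ τ, 0 < τ → MemLp q 2 (volume.restrict (Ioc 0 τ)))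
    (h : ∀ᵐ s ∂volume.restrict (Ioi (0 : ℝ)), ∀ t, 0 ≤ t →
      (inner ℝ (w t) (w s) : ℝ) = inner ℝ (∫ r in (0 : ℝ)..t, p r) (q s))
    {t : ℝ} (ht : 0 < t) :
    ‖w t‖ ^ 2 = 2 * ∫ s in (0 : ℝ)..t, (inner ℝ (p s) (q s) : ℝ) := by
  -- Truncation gives square-integrable functions on the whole line; the extra unit of time leaves
  -- room for shifts `δ ≤ 1`.
  set I := Ioc (0 : ℝ) (t + 1) with hI
  have hpI : MemLp (I.indicator p) 2 volume :=
    (memLp_indicator_iff_restrict measurableSet_Ioc).2 (hp _ (by linarith))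
  have hqI : MemLp (I.indicator q) 2 volume :=
    (memLp_indicator_iff_restrict measurableSet_Ioc).2 (hq _ (by linarith))
  set f := hpI.toLp _ with hf
  set g := hqI.toLp _ with hg
  have hfp : ∀ᵐ s, s ∈ I → f s = p s := by
    filter_upwards [hpI.coeFn_toLp] with s hs hsI
    rw [hf, hs, indicator_of_mem hsI]
  have hgq : ∀ᵐ s, s ∈ I → g s = q s := by
    filter_upwards [hqI.coeFn_toLp] with s hs hsI
    rw [hg, hs, indicator_of_mem hsI]
  set c : ℝ × ℝ → ℝ := fun z =>
    ∫ s in Ioc 0 t, (inner ℝ (f (s + z.1)) (g s + g (s + z.2)) : ℝ) with hc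
  have hcc : Continuous c := continuous_inner_translate f g t
  set E : ℝ → ℝ := fun s => ‖w s‖ ^ 2 with hE
  have hEc : ContinuousOn E (Ici 0) := hw.norm.pow 2
  have hpint : ∀ τ, 0 < τ → IntegrableOn p (Ioc 0 τ) := fun τ hτ =>
    (hp τ hτ).integrable (by norm_num)
  have hpii : ∀ a b, 0 ≤ a → 0 ≤ b → IntervalIntegrable p volume a b := by
    intro a b ha hb
    rw [intervalIntegrable_iff]
    refine (hpint (max a b + 1) (by positivity)).mono_set fun x hx => ?_
    exact ⟨lt_of_le_of_lt (le_min ha hb) hx.1, hx.2.trans (by linarith)⟩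
  have hEii : ∀ a b, 0 ≤ a → 0 ≤ b → IntervalIntegrable E volume a b := by
    intro a b ha hb
    refine (hEc.mono fun x hx => ?_).intervalIntegrable
    exact le_trans (le_min ha hb) hx.1
  -- the increments of the energy
  have hinc : ∀ δ, 0 < δ → δ ≤ 1 →
      (∫ s in t..(t + δ), E s) - ∫ s in (0 : ℝ)..(0 + δ), E s = ∫ ρ in (0 : ℝ)..(0 + δ), c (ρ, δ) := by
    intro δ hδ hδ1
    have hpt : ∀ᵐ s ∂volume.restrict (Ioc 0 t), E (s + δ) - E s =
        ∫ ρ in Ioc 0 δ, (inner ℝ (f (s + ρ)) (g s + g (s + δ)) : ℝ) := by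
      have h1 : ∀ᵐ s : ℝ, 0 < s → ∀ t, 0 ≤ t →
          (inner ℝ (w t) (w s) : ℝ) = inner ℝ (∫ r in (0 : ℝ)..t, p r) (q s) :=
        (ae_restrict_iff' measurableSet_Ioi).1 h
      have h2 := (measurePreserving_add_right (volume : Measure ℝ) δ).quasiMeasurePreserving.ae h1
      have h3 := (measurePreserving_add_right (volume : Measure ℝ) δ).quasiMeasurePreserving.ae hgq
      rw [ae_restrict_iff' measurableSet_Ioc]
      filter_upwards [h1, h2, hgq, h3] with s hs1 hs2 hs3 hs4 hs
      have hs0 := hs.1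
      have hsδ : 0 < s + δ := by linarith
      -- Symmetric factorization: the increment of `w` becomes `∫ p` over `[s, s + δ]`, and each
      -- value of `w` in the sum becomes a value of `q`.
      have e1 : E (s + δ) - E s = inner ℝ (w (s + δ) - w s) (w s + w (s + δ)) := by
        simp only [hE, inner_sub_left, inner_add_right, ← real_inner_self_eq_norm_sq]
        rw [real_inner_comm (w s) (w (s + δ))]
        ring
      have e2 : (∫ r in (0 : ℝ)..(s + δ), p r) - ∫ r in (0 : ℝ)..s, p r =
          ∫ r in s..(s + δ), p r :=
        intervalIntegral.integral_interval_sub_left (hpii _ _ le_rfl hsδ.le) (hpii _ _ le_rfl hs0.le)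
      have e3 : ∫ r in s..(s + δ), p r = ∫ ρ in Ioc 0 δ, f (s + ρ) := by
        rw [← intervalIntegral.integral_of_le hδ.le,
          intervalIntegral.integral_comp_add_left (fun r => f r) s, add_zero]
        refine intervalIntegral.integral_congr_ae ?_
        filter_upwards [hfp] with r hr hr'
        rw [uIoc_of_le (by linarith)] at hr'
        rw [hr ⟨hs0.trans hr'.1, hr'.2.trans (by linarith [hs.2])⟩]
      have hfi : IntegrableOn (fun ρ => f (s + ρ)) (Ioc 0 δ) := by
        have h5 : IntervalIntegrable (fun r => f r) volume (s + 0) (s + δ) := by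
          rw [intervalIntegrable_iff, uIoc_of_le (by linarith)]
          exact ((Lp.memLp f).restrict (Ioc (s + 0) (s + δ))).integrable (by norm_num)
        rw [← intervalIntegrable_iff_integrableOn_Ioc_of_le hδ.le]
        have := h5.comp_add_left s
        simpa using this
      have hsI : s ∈ I := ⟨hs0, by linarith [hs.2]⟩
      have hsδI : s + δ ∈ I := ⟨hsδ, by linarith [hs.2]⟩
      rw [e1, inner_add_right, inner_sub_left, inner_sub_left, hs1 hs0 _ hsδ.le, hs1 hs0 _ hs0.le,
        hs2 hsδ _ hsδ.le, hs2 hsδ _ hs0.le, ← inner_sub_left, ← inner_sub_left, e2, e3,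
        ← hs3 hsI, ← hs4 hsδI, ← inner_add_right, real_inner_comm, ← integral_inner hfi]
      simp only [real_inner_comm]
    have h1 : ∫ s in Ioc 0 t, (E (s + δ) - E s) = ∫ ρ in Ioc 0 δ, c (ρ, δ) := by
      rw [integral_congr_ae hpt, integral_integral_swap (integrable_inner_translate f g t δ)]
    rw [zero_add, intervalIntegral.integral_of_le (f := fun ρ => c (ρ, δ)) hδ.le, ← h1,
      ← intervalIntegral.integral_of_le ht.le, intervalIntegral.integral_sub,
      intervalIntegral.integral_comp_add_right, zero_add]
    · have := intervalIntegral.integral_add_adjacent_intervals (hEii 0 δ le_rfl hδ.le)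
        (hEii δ (t + δ) hδ.le (by linarith))
      have := intervalIntegral.integral_add_adjacent_intervals (hEii 0 t le_rfl ht.le)
        (hEii t (t + δ) ht.le (by linarith))
      linarith
    · have := (hEii (0 + δ) (t + δ) (by linarith) (by linarith)).comp_add_right δ
      simpa using this
    · exact hEii 0 t le_rfl ht.le
  have hc0 : c (0, 0) = 2 * ∫ s in (0 : ℝ)..t, (inner ℝ (p s) (q s) : ℝ) := by
    rw [intervalIntegral.integral_of_le ht.le, ← integral_const_mul]
    refine integral_congr_ae ?_
    rw [EventuallyEq, ae_restrict_iff' measurableSet_Ioc]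
    filter_upwards [hfp, hgq] with s h1 h2 hs
    have hsI : s ∈ I := ⟨hs.1, by linarith [hs.2]⟩
    simp only [add_zero]
    rw [h1 hsI, h2 hsI, inner_add_right]; ring
  -- Divide `hinc` by `δ`: the three averages over intervals of length `δ` tend to `E t`, `E 0` and
  -- `c (0, 0)`, each contributing one `ε`.
  have hlim : ∀ ε > 0, |(E t - E 0) - c (0, 0)| ≤ 3 * ε := by
    intro ε hε
    have h1 : ∀ᶠ x in 𝓝[≥] t, |E x - E t| ≤ ε := by
      have := (hEc t ht.le).tendsto.mono_left (nhdsWithin_mono t (Ici_subset_Ici.2 ht.le))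
      filter_upwards [Metric.tendsto_nhds.1 this ε hε] with x hx
      exact (Real.dist_eq _ _ ▸ hx).le
    have h2 : ∀ᶠ x in 𝓝[≥] (0 : ℝ), |E x - E 0| ≤ ε := by
      filter_upwards [Metric.tendsto_nhds.1 (hEc 0 self_mem_Ici).tendsto ε hε] with x hx
      exact (Real.dist_eq _ _ ▸ hx).le
    obtain ⟨r1, hr1, h1⟩ := mem_nhdsGE_iff_exists_Icc_subset.1 h1
    obtain ⟨r2, hr2, h2⟩ := mem_nhdsGE_iff_exists_Icc_subset.1 h2
    obtain ⟨r3, hr3, h3⟩ := Metric.continuousAt_iff.1 (hcc.continuousAt (x := (0, 0))) ε hε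
    set δ := min (min (r1 - t) r2) (min (r3 / 2) 1) with hδ
    have hδ0 : 0 < δ := by
      refine lt_min (lt_min (by linarith) hr2) (lt_min (by linarith) one_pos)
    have d1 : δ ≤ r1 - t := (min_le_left _ _).trans (min_le_left _ _)
    have d2 : δ ≤ r2 := (min_le_left _ _).trans (min_le_right _ _)
    have d3 : δ ≤ r3 / 2 := (min_le_right _ _).trans (min_le_left _ _)
    have d4 : δ ≤ 1 := (min_le_right _ _).trans (min_le_right _ _)
    have a1 := norm_setIntegral_sub_const_le (k := E) (a := t) (c := E t) (ε := ε) hδ0.le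
      (hEii _ _ ht.le (by linarith)) fun x hx => h1 ⟨hx.1, hx.2.trans (by linarith)⟩
    have a2 := norm_setIntegral_sub_const_le (k := E) (a := 0) (c := E 0) (ε := ε) hδ0.le
      (hEii _ _ le_rfl (by linarith)) fun x hx => h2 ⟨hx.1, hx.2.trans (by linarith)⟩
    have a3 := norm_setIntegral_sub_const_le (k := fun ρ => c (ρ, δ)) (a := 0) (c := c (0, 0))
      (ε := ε) hδ0.le ((hcc.comp (by fun_prop)).intervalIntegrable _ _) fun x hx => by
        have : dist (x, δ) ((0 : ℝ), (0 : ℝ)) < r3 := by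
          rw [Prod.dist_eq, max_lt_iff]
          simp only [Real.dist_eq, sub_zero]
          rw [abs_of_nonneg hx.1, abs_of_pos hδ0]
          constructor <;> linarith [hx.2]
        exact (Real.dist_eq _ _ ▸ h3 this).le
    have a4 := hinc δ hδ0 d4
    have a5 : |δ * ((E t - E 0) - c (0, 0))| ≤ δ * (3 * ε) := by
      rw [abs_le] at a1 a2 a3 ⊢
      constructor <;> nlinarith
    rw [abs_mul, abs_of_pos hδ0] at a5
    exact le_of_mul_le_mul_left a5 hδ0
  have hfin : |(E t - E 0) - c (0, 0)| ≤ 0 := by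
    refine le_of_forall_pos_le_add fun ε hε => ?_
    have := hlim (ε / 3) (by positivity)
    linarith
  have hE0 : E 0 = 0 := by simp [hE, hw0]
  have := abs_nonpos_iff.1 hfin
  rw [hE0, hc0] at this
  change E t = _
  linarith

end Energy

/-! ### The conformal map at infinity and boundedness of the background field. -/

section Conformal

/-- The exterior of a disc is the image of a half-plane under the exponential. -/
theorem isPreconnected_setOf_lt_norm {M : ℝ} (hM : 0 < M) : IsPreconnected {w : ℂ | M < ‖w‖} := by
  have h : {w : ℂ | M < ‖w‖} = Complex.exp '' {z : ℂ | Real.log M < z.re} := by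
    ext w
    constructor
    · intro hw
      have hw' : M < ‖w‖ := hw
      have hw0 : w ≠ 0 := norm_pos_iff.1 (hM.trans hw')
      exact ⟨Complex.log w, by simpa [Complex.log_re] using Real.log_lt_log hM hw',
        Complex.exp_log hw0⟩
    · rintro ⟨z, hz, rfl⟩
      simp only [mem_ofPred_eq, Complex.norm_exp] at hz ⊢
      exact (Real.log_lt_iff_lt_exp hM).1 hz
  rw [h]
  exact (convex_halfSpace_re_gt _).isPreconnected.image _ Complex.continuous_exp.continuousOn

/-- The logarithmic derivative of a nonzero analytic function has at most a simple pole. -/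
theorem exists_norm_mul_deriv_le {G : ℂ → ℂ} (hG : AnalyticAt ℂ G 0)
    (hne : ¬ ∀ᶠ z in 𝓝 0, G z = 0) :
    ∃ C : ℝ, ∀ᶠ z in 𝓝[≠] (0 : ℂ), ‖z * deriv G z‖ ≤ C * ‖G z‖ := by
  obtain ⟨n, h, hh, hh0, heq⟩ := hG.exists_eventuallyEq_pow_smul_nonzero_iff.2 hne
  -- With `G = zⁿ h` and `h 0 ≠ 0`, one has `z G' = zⁿ (n h + z h')`; the extra `1` pays for `z h'`,
  -- which is smaller than `h` near `0`.
  refine ⟨n + 1, ?_⟩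
  have h1 : ∀ᶠ z in 𝓝 (0 : ℂ), ‖z * deriv h z‖ < ‖h z‖ := by
    have ha : Tendsto (fun z => ‖z * deriv h z‖) (𝓝 0) (𝓝 ‖(0 : ℂ) * deriv h 0‖) :=
      (tendsto_id.mul hh.deriv.continuousAt.tendsto).norm
    rw [zero_mul, norm_zero] at ha
    exact ha.eventually_lt hh.continuousAt.tendsto.norm (by simpa using hh0)
  filter_upwards [nhdsWithin_le_nhds h1, nhdsWithin_le_nhds heq.eventually_nhds,
    nhdsWithin_le_nhds hh.eventually_analyticAt, self_mem_nhdsWithin] with z hz1 hz2 hz3 hz0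
  have hd : deriv G z = n * z ^ (n - 1) * h z + z ^ n * deriv h z := by
    have h2 : G =ᶠ[𝓝 z] fun z => z ^ n * h z := by
      filter_upwards [hz2] with y hy
      simpa using hy
    rw [h2.deriv_eq]
    exact ((hasDerivAt_pow n z).mul hz3.differentiableAt.hasDerivAt).deriv
  have hGz : G z = z ^ n * h z := by simpa using hz2.self_of_nhds
  have h3 : z * deriv G z = z ^ n * (n * h z + z * deriv h z) := by
    rw [hd]
    rcases n with _ | n
    · simp
    · simp only [Nat.add_sub_cancel]; ring
  rw [h3, hGz, norm_mul, norm_mul]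
  have h4 : ‖(n : ℂ) * h z + z * deriv h z‖ ≤ (n + 1) * ‖h z‖ := by
    refine (norm_add_le _ _).trans ?_
    rw [norm_mul, Complex.norm_natCast]
    linarith
  calc ‖z ^ n‖ * ‖(n : ℂ) * h z + z * deriv h z‖ ≤ ‖z ^ n‖ * ((n + 1) * ‖h z‖) := by gcongr
    _ = _ := by ring

variable {Γ : Set ℂ} {T : ℂ → ℂ}

/-- The reciprocal of `T` in the coordinate at infinity extends holomorphically by `0`. -/
theorem IsBiholomorphism.exists_extension_at_infinity (hΓ : IsCompact Γ)
    (hT : IsBiholomorphism T Γᶜ {w : ℂ | 1 < ‖w‖}) :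
    ∃ G : ℂ → ℂ, AnalyticAt ℂ G 0 ∧ G 0 = 0 ∧ ∀ᶠ z in 𝓝[≠] (0 : ℂ),
      z⁻¹ ∈ Γᶜ ∧ G z = (T z⁻¹)⁻¹ := by
  obtain ⟨hTd, hbij, S, hSd, hinv⟩ := hT
  obtain ⟨R, hR0, hR⟩ := hΓ.isBounded.subset_closedBall_lt 0 0
  have hmem : ∀ z : ℂ, z ≠ 0 → ‖z‖ < R⁻¹ → z⁻¹ ∈ Γᶜ := by
    intro z hz hzR hzΓ
    have h1 := hR hzΓ
    rw [mem_closedBall_zero_iff, norm_inv] at h1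
    exact absurd h1 (not_le.2 ((lt_inv_comm₀ (norm_pos_iff.2 hz) hR0).1 hzR))
  set B := Metric.ball (0 : ℂ) R⁻¹ with hB
  have hB0 : B ∈ 𝓝 (0 : ℂ) := Metric.ball_mem_nhds _ (inv_pos.2 hR0)
  set g : ℂ → ℂ := fun z => (T z⁻¹)⁻¹ with hg
  have hmemB : ∀ z ∈ B \ {0}, z⁻¹ ∈ Γᶜ := fun z hz =>
    hmem z (by simpa using hz.2) (by simpa [hB] using hz.1)
  have hT1 : ∀ x ∈ Γᶜ, 1 < ‖T x‖ := fun x hx => hbij.mapsTo hx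
  have hgd : DifferentiableOn ℂ g (B \ {0}) := by
    have h1 : DifferentiableOn ℂ (fun z : ℂ => z⁻¹) (B \ {0}) := fun z hz =>
      (differentiableAt_inv (by simpa using hz.2)).differentiableWithinAt
    refine (hTd.comp h1 hmemB).inv fun z hz => ?_
    exact norm_pos_iff.1 (one_pos.trans (hT1 _ (hmemB z hz)))
  have hg1 : ∀ z ∈ B \ {0}, ‖g z‖ < 1 := fun z hz => by
    rw [hg, norm_inv]; exact inv_lt_one_of_one_lt₀ (hT1 _ (hmemB z hz))
  -- Removable singularity: `g` is bounded by `1` because `|T| > 1`.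
  have hext := Complex.differentiableOn_update_limUnder_of_bddAbove hB0 hgd
    ⟨1, by rintro _ ⟨z, hz, rfl⟩; exact (hg1 z hz).le⟩
  set L := limUnder (𝓝[≠] (0 : ℂ)) g with hL
  set G := Function.update g 0 L with hG
  have hGg : ∀ z ≠ 0, G z = g z := fun z hz => Function.update_of_ne hz _ _
  have hGL : G 0 = L := Function.update_self _ _ _
  have hGan : AnalyticAt ℂ G 0 := hext.analyticAt hB0
  have hev : ∀ᶠ z in 𝓝[≠] (0 : ℂ), z ∈ B \ {0} := by
    filter_upwards [self_mem_nhdsWithin, nhdsWithin_le_nhds hB0] with z h1 h2 using ⟨h2, h1⟩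
  have hlim : Tendsto g (𝓝[≠] 0) (𝓝 L) := by
    have h1 : Tendsto G (𝓝[≠] 0) (𝓝 L) := hGL ▸ hGan.continuousAt.tendsto.mono_left nhdsWithin_le_nhds
    refine h1.congr' ?_
    filter_upwards [self_mem_nhdsWithin] with z hz using hGg z hz
  have hL1 : ‖L‖ ≤ 1 := le_of_tendsto hlim.norm (hev.mono fun z hz => (hg1 z hz).le)
  -- Maximum principle: if `|L| = 1`, then `G` would be constant near `0`, against `|g| < 1` off
  -- `0`.
  have hL1' : ‖L‖ < 1 := by
    refine lt_of_le_of_ne hL1 fun hL1 => ?_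
    have hmax : IsLocalMax (norm ∘ G) 0 := by
      filter_upwards [hB0] with z hz
      rcases eq_or_ne z 0 with rfl | hz0
      · exact le_rfl
      · simp only [Function.comp, hGL, hL1, hGg z hz0]
        exact (hg1 z ⟨hz, hz0⟩).le
    have h2 := Complex.eventually_eq_of_isLocalMax_norm
      (hGan.eventually_analyticAt.mono fun z hz => hz.differentiableAt) hmax
    obtain ⟨z, hz, hz'⟩ := (hev.and (nhdsWithin_le_nhds h2)).exists
    have h3 := hg1 z hz
    rw [← hGg z hz.2, hz', hGL, hL1] at h3
    exact lt_irrefl _ h3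
  -- Otherwise `1/L` lies in the domain of the inverse map `S`, and continuity there would force
  -- `z⁻¹ = S (T z⁻¹)` to converge as `z → 0`.
  have hL0 : L = 0 := by
    by_contra hL0
    have hLi : L⁻¹ ∈ {w : ℂ | 1 < ‖w‖} := by
      simp only [mem_ofPred_eq, norm_inv]
      exact (one_lt_inv₀ (norm_pos_iff.2 hL0)).2 hL1'
    have hop : IsOpen {w : ℂ | 1 < ‖w‖} := isOpen_lt continuous_const continuous_norm
    have h1 : Tendsto (fun z => S (g z)⁻¹) (𝓝[≠] 0) (𝓝 (S L⁻¹)) :=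
      (hSd.continuousOn.continuousAt (hop.mem_nhds hLi)).tendsto.comp (hlim.inv₀ hL0)
    have h2 : Tendsto (fun z : ℂ => z⁻¹) (𝓝[≠] 0) (𝓝 (S L⁻¹)) := by
      refine h1.congr' (hev.mono fun z hz => ?_)
      simp only [hg, inv_inv]
      exact hinv.1 (hmemB z hz)
    exact not_tendsto_nhds_of_tendsto_atTop (tendsto_norm_inv_nhdsNE_zero_atTop (α := ℂ)) _ h2.norm
  refine ⟨G, hGan, hGL.trans hL0, hev.mono fun z hz => ⟨hmemB z hz, hGg z hz.2⟩⟩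

/-- The logarithmic derivative of the conformal map is bounded away from the curve. -/
theorem IsBiholomorphism.exists_norm_deriv_le (hΓ : IsCompact Γ)
    (hT : IsBiholomorphism T Γᶜ {w : ℂ | 1 < ‖w‖}) :
    ∃ C : ℝ, ∀ x ∈ Γᶜ, 3 ≤ ‖T x‖ → ‖deriv T x‖ ≤ C * ‖T x‖ := by
  obtain ⟨G, hGan, hG0, hGev⟩ := hT.exists_extension_at_infinity hΓ
  obtain ⟨hTd, hbij, S, hSd, hinv⟩ := hT
  have hΩ : IsOpen Γᶜ := hΓ.isClosed.isOpen_compl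
  have hT1 : ∀ x ∈ Γᶜ, 1 < ‖T x‖ := fun x hx => hbij.mapsTo hx
  have hGne : ¬ ∀ᶠ z in 𝓝 0, G z = 0 := by
    intro h
    obtain ⟨z, hz, hz'⟩ := (hGev.and (nhdsWithin_le_nhds h)).exists
    rw [hz.2, inv_eq_zero] at hz'
    have := hT1 _ hz.1
    rw [hz', norm_zero] at this
    linarith
  obtain ⟨C, hC⟩ := exists_norm_mul_deriv_le hGan hGne
  obtain ⟨r, hr0, hr⟩ := Metric.mem_nhdsWithin_iff.1 (hGev.and hC)
  replace hr : ∀ z : ℂ, z ≠ 0 → ‖z‖ < r →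
      (z⁻¹ ∈ Γᶜ ∧ G z = (T z⁻¹)⁻¹) ∧ ‖z * deriv G z‖ ≤ C * ‖G z‖ := fun z hz hzr =>
    hr ⟨by simpa using hzr, hz⟩
  -- Since `G'(1/x) = T'(x) x² / T(x)²`, the bound on `z G' / G` at `z = 1/x` reads `|x| |T'| ≤ C
  -- |T|`, and `1 ≤ r |x|`.
  have hfar : ∀ x : ℂ, r⁻¹ < ‖x‖ → x ∈ Γᶜ ∧ ‖deriv T x‖ ≤ |C| * r * ‖T x‖ := by
    intro x hx
    have hx0 : x ≠ 0 := norm_pos_iff.1 ((inv_pos.2 hr0).trans hx)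
    have hxr : ‖x⁻¹‖ < r := by rw [norm_inv]; exact inv_lt_of_inv_lt₀ hr0 hx
    obtain ⟨⟨h1, h2⟩, h3⟩ := hr x⁻¹ (inv_ne_zero hx0) hxr
    rw [inv_inv] at h1 h2
    refine ⟨h1, ?_⟩
    have hTx : T x ≠ 0 := norm_pos_iff.1 (one_pos.trans (hT1 x h1))
    have hev : ∀ᶠ z in 𝓝 x⁻¹, G z = (T z⁻¹)⁻¹ := by
      have ho : IsOpen {z : ℂ | z ≠ 0 ∧ ‖z‖ < r} :=
        isOpen_ne.inter (isOpen_lt continuous_norm continuous_const)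
      filter_upwards [ho.mem_nhds ⟨inv_ne_zero hx0, hxr⟩] with z hz
      exact (hr z hz.1 hz.2).1.2
    have hTdx : HasDerivAt T (deriv T x) (x⁻¹)⁻¹ := by
      rw [inv_inv]; exact (hTd.differentiableAt (hΩ.mem_nhds h1)).hasDerivAt
    have hd : deriv G x⁻¹ = deriv T x * x ^ 2 / (T x) ^ 2 := by
      rw [EventuallyEq.deriv_eq hev]
      have := ((hTdx.comp x⁻¹ (hasDerivAt_inv (inv_ne_zero hx0))).fun_inv (by simpa using hTx)).deriv
      simp only [Function.comp, inv_inv] at this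
      rw [this]; field_simp
    rw [hd, h2, norm_mul, norm_div, norm_mul, norm_inv, norm_inv, norm_pow, norm_pow] at h3
    have hX : 0 < ‖x‖ := norm_pos_iff.2 hx0
    have hY : 0 < ‖T x‖ := norm_pos_iff.2 hTx
    have h4 : ‖deriv T x‖ * ‖x‖ ≤ C * ‖T x‖ := by
      have := mul_le_mul_of_nonneg_right h3 (sq_nonneg ‖T x‖)
      field_simp at this
      linarith
    have h5 : 1 ≤ r * ‖x‖ := by
      have := mul_le_mul_of_nonneg_left hx.le hr0.le
      rwa [mul_inv_cancel₀ hr0.ne'] at this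
    calc ‖deriv T x‖ ≤ ‖deriv T x‖ * (r * ‖x‖) := le_mul_of_one_le_right (norm_nonneg _) h5
      _ = r * (‖deriv T x‖ * ‖x‖) := by ring
      _ ≤ r * (|C| * ‖T x‖) := by
        exact mul_le_mul_of_nonneg_left
          (h4.trans (mul_le_mul_of_nonneg_right (le_abs_self C) hY.le)) hr0.le
      _ = _ := by ring
  set R := r⁻¹ + 1 with hR
  have hRr : r⁻¹ < R := by linarith
  have hR0 : 0 < R := by positivity
  have hsph : Metric.sphere (0 : ℂ) R ⊆ Γᶜ := fun x hx =>
    (hfar x (by rw [mem_sphere_zero_iff_norm.1 hx]; exact hRr)).1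
  obtain ⟨M₀, hM₀⟩ := (isCompact_sphere (0 : ℂ) R).exists_bound_of_continuousOn
    (hTd.continuousOn.mono hsph)
  set M := max M₀ 3 with hM
  have hM3 : 3 ≤ M := le_max_right _ _
  have hSc : ContinuousOn S {w : ℂ | 1 < ‖w‖} := hSd.continuousOn
  have hbig : ∃ y ∈ Γᶜ, R < ‖y‖ ∧ M < ‖T y‖ := by
    have h1 : ∀ᶠ z in 𝓝[≠] (0 : ℂ), ‖G z‖ < M⁻¹ := by
      have := (hGan.continuousAt.tendsto.mono_left (nhdsWithin_le_nhds (s := {0}ᶜ))).norm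
      rw [hG0, norm_zero] at this
      exact this.eventually_lt_const (by positivity)
    have h2 := (tendsto_norm_inv_nhdsNE_zero_atTop (α := ℂ)).eventually_gt_atTop R
    obtain ⟨z, ⟨hz1, hz2⟩, hz3, hz4⟩ := ((h1.and h2).and hGev).exists
    refine ⟨z⁻¹, hz3, hz2, ?_⟩
    rw [hz4, norm_inv] at hz1
    exact (inv_lt_inv₀ (by linarith [hT1 _ hz3]) (by linarith)).1 hz1
  -- The image under `S` of the connected set `{|w| > M}` contains a point outside the disc of
  -- radius `R`. If it also met the disc, it would meet the circle, where `|T| ≤ M₀ ≤ M`.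
  have hnear : ∀ x ∈ Γᶜ, ‖x‖ ≤ R → ‖T x‖ ≤ M := by
    intro x hx hxR
    by_contra! hlt
    obtain ⟨y, hy, hyR, hyM⟩ := hbig
    have hpre := isPreconnected_setOf_lt_norm (M := M) (by linarith)
    have hsub : {w : ℂ | M < ‖w‖} ⊆ {w : ℂ | 1 < ‖w‖} := fun w (hw : M < ‖w‖) => by
      simp only [mem_ofPred_eq]; linarith
    have hiv := hpre.intermediate_value (a := T x) (b := T y) hlt hyM (hSc.mono hsub).norm
    rw [hinv.1 hx, hinv.1 hy] at hiv
    obtain ⟨w, hw, hwR⟩ := hiv ⟨hxR, hyR.le⟩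
    have h1 := hM₀ (S w) (mem_sphere_zero_iff_norm.2 hwR)
    rw [hinv.2 (hsub hw)] at h1
    have : M < ‖w‖ := hw
    have : M₀ ≤ M := le_max_left _ _
    linarith
  -- The remaining points are in the image under `S` of this compact annulus, a compact subset of
  -- `Γᶜ` on which `T'` is bounded.
  set A := {w : ℂ | 3 ≤ ‖w‖} ∩ Metric.closedBall 0 M with hA
  have hAc : IsCompact A :=
    (isCompact_closedBall _ _).inter_left (isClosed_le continuous_const continuous_norm)
  have hA1 : A ⊆ {w : ℂ | 1 < ‖w‖} := fun w hw => by
    have : 3 ≤ ‖w‖ := hw.1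
    simp only [mem_ofPred_eq]; linarith
  have hSA : S '' A ⊆ Γᶜ := by
    rintro _ ⟨w, hw, rfl⟩
    obtain ⟨x, hx, rfl⟩ := hbij.surjOn (hA1 hw)
    rw [hinv.1 hx]; exact hx
  obtain ⟨C₂, hC₂⟩ := (hAc.image_of_continuousOn (hSc.mono hA1)).exists_bound_of_continuousOn
    ((hTd.deriv hΩ).continuousOn.mono hSA)
  refine ⟨max (|C| * r) |C₂|, fun x hx hx3 => ?_⟩
  rcases lt_or_ge R ‖x‖ with hxR | hxR
  · exact (hfar x (hRr.trans hxR)).2.trans (by gcongr; exact le_max_left _ _)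
  · have h1 := hC₂ x ⟨T x, ⟨hx3, by simpa using hnear x hx hxR⟩, hinv.1 hx⟩
    calc ‖deriv T x‖ ≤ |C₂| := h1.trans (le_abs_self _)
      _ ≤ |C₂| * ‖T x‖ := le_mul_of_one_le_right (abs_nonneg _) (by linarith)
      _ ≤ _ := by gcongr; exact le_max_right _ _

theorem isCompact_arc {γ : ℝ → ℂ} (hγ : IsC2JordanArc γ) : IsCompact (arc γ) :=
  isCompact_Icc.image_of_continuousOn hγ.contDiffOn.continuousOn

/-- The derivative of `T` may blow up at the tips of the arc, but there the cutoff vanishes; where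
`|T| ≥ 3` the harmonic field is controlled by `|T'| / |T|`. -/
theorem memLp_top_backgroundField (hΓ : IsCompact Γ)
    (hT : IsBiholomorphism T Γᶜ {w : ℂ | 1 < ‖w‖}) {Φ : ℝ → ℝ} (hΦ : IsCutoffProfile Φ)
    {lam : ℝ} (hlam : 2 ≤ lam) (α : ℝ) :
    MemLp (backgroundField T Φ lam α) ⊤ (volume.restrict Γᶜ) := by
  obtain ⟨C, hC⟩ := hT.exists_norm_deriv_le hΓ
  have hΩ : IsOpen Γᶜ := hΓ.isClosed.isOpen_compl
  have hTc : ContinuousOn T Γᶜ := hT.1.continuousOn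
  have hT1 : ∀ x ∈ Γᶜ, 1 < ‖T x‖ := fun x hx => hT.2.1.mapsTo hx
  have hfd : ∀ x ∈ Γᶜ, fderiv ℝ T x = (fderiv ℂ T x).restrictScalars ℝ := fun x hx =>
    ((hT.1.differentiableAt (hΩ.mem_nhds hx)).hasFDerivAt.restrictScalars ℝ).fderiv
  have hnorm : ∀ x ∈ Γᶜ, ‖fderiv ℝ T x‖ = ‖deriv T x‖ := fun x hx => by
    rw [hfd x hx, ContinuousLinearMap.norm_restrictScalars, norm_deriv_eq_norm_fderiv]
  refine memLp_top_of_bound ?_ (|α| * (1 / (2 * Real.pi) * |C|)) ?_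
  · refine ContinuousOn.aestronglyMeasurable ?_ hΩ.measurableSet
    have hfc : ContinuousOn (fderiv ℝ T) Γᶜ :=
      (((hT.1.contDiffOn (n := 1) hΩ).restrict_scalars ℝ).continuousOn_fderiv_of_isOpen hΩ le_rfl)
    have hadj : ContinuousOn (fun x => ContinuousLinearMap.adjoint (fderiv ℝ T x)) Γᶜ :=
      (LinearIsometryEquiv.continuous _).comp_continuousOn hfc
    have h2 : ContinuousOn (fun x => ((‖T x‖ ^ 2)⁻¹ : ℝ)) Γᶜ :=
      (hTc.norm.pow 2).inv₀ fun x hx => by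
        exact (pow_pos (one_pos.trans (hT1 x hx)) 2).ne'
    refine ContinuousOn.smul (continuousOn_const.mul (hΦ.contDiff.continuous.comp_continuousOn
      ((hTc.norm.sub continuousOn_const).div_const _))) ?_
    have h3 : ContinuousOn (fun x => perp (T x)) Γᶜ := continuousOn_const.mul hTc
    have h4 : ContinuousOn (fun x => jacobianTranspose T x (((‖T x‖ ^ 2)⁻¹ : ℝ) • perp (T x))) Γᶜ :=
      hadj.clm_apply (h2.smul h3)
    exact h4.const_smul (1 / (2 * Real.pi) : ℝ)
  · refine (ae_restrict_iff' hΩ.measurableSet).2 (Eventually.of_forall fun x hx => ?_)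
    have hpi := Real.pi_pos
    have hT0 := hT1 x hx
    rw [backgroundField, norm_smul, Real.norm_eq_abs, abs_mul]
    by_cases h3 : 3 ≤ ‖T x‖
    · have hb : ‖harmonicField T x‖ ≤ 1 / (2 * Real.pi) * |C| := by
        rw [harmonicField, norm_smul, Real.norm_of_nonneg (by positivity)]
        gcongr
        rw [jacobianTranspose]
        refine (ContinuousLinearMap.le_opNorm _ _).trans ?_
        rw [LinearIsometryEquiv.norm_map, hnorm x hx, perp, norm_smul, norm_mul, Complex.norm_I,
          one_mul, norm_inv, norm_pow, norm_norm]
        have : (‖T x‖ ^ 2)⁻¹ * ‖T x‖ = ‖T x‖⁻¹ := by field_simp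
        rw [this, ← div_eq_mul_inv, div_le_iff₀ (by linarith)]
        exact (hC x hx h3).trans (mul_le_mul_of_nonneg_right (le_abs_self C) (by linarith))
      obtain ⟨h4, h5⟩ := hΦ.mem_Icc ((‖T x‖ - 1) / lam)
      rw [abs_of_nonneg h4]
      have h6 : |α| * Φ ((‖T x‖ - 1) / lam) ≤ |α| := mul_le_of_le_one_right (abs_nonneg _) h5
      exact mul_le_mul h6 hb (norm_nonneg _) (abs_nonneg _)
    -- This is where `lam ≥ 2` matters: `|T| < 3` puts the point in the zero set of the cutoff.
    · have : (‖T x‖ - 1) / lam ≤ 1 := by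
        rw [div_le_one (by linarith)]; linarith
      rw [hΦ.eq_zero _ this]
      simp only [abs_zero, mul_zero, zero_mul]
      positivity

end Conformal

/-! ### Ladyzhenskaya's inequality and the embedding of `𝓥` into `L⁴`. -/

section Ladyzhenskaya

instance fact_one_le_four : Fact ((1 : ENNReal) ≤ 4) := ⟨by norm_num⟩

theorem norm_le_norm_apply_one_add (L : ℂ →L[ℝ] ℂ) : ‖L‖ ≤ ‖L 1‖ + ‖L Complex.I‖ := by
  refine L.opNorm_le_bound (by positivity) fun z => ?_
  have h : L z = z.re • L 1 + z.im • L Complex.I := by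
    rw [← map_smul, ← map_smul, ← map_add]
    congr 1
    apply Complex.ext <;> simp
  rw [h, add_mul]
  refine (norm_add_le _ _).trans ?_
  rw [norm_smul, norm_smul, mul_comm, mul_comm ‖z.im‖]
  gcongr
  · exact Complex.abs_re_le_norm z
  · exact Complex.abs_im_le_norm z

theorem norm_fderiv_norm_sq_le {φ : ℂ → ℂ} {x : ℂ} (hφ : DifferentiableAt ℝ φ x) :
    ‖fderiv ℝ (fun x => ‖φ x‖ ^ 2) x‖ ≤
      2 * ((‖fderiv ℝ φ x 1‖ + ‖fderiv ℝ φ x Complex.I‖) * ‖φ x‖) := by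
  rw [hφ.hasFDerivAt.norm_sq.fderiv]
  refine ContinuousLinearMap.opNorm_le_bound _ (by positivity) fun z => ?_
  rw [_root_.smul_apply, ContinuousLinearMap.comp_apply, innerSL_apply_apply, nsmul_eq_mul, norm_mul]
  have h5 : ‖(inner ℝ (φ x) (fderiv ℝ φ x z) : ℝ)‖ ≤ ‖φ x‖ * (‖fderiv ℝ φ x‖ * ‖z‖) :=
    (norm_inner_le_norm _ _).trans (by gcongr; exact ContinuousLinearMap.le_opNorm _ _)
  have h7 := mul_le_mul_of_nonneg_left (mul_le_mul_of_nonneg_right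
    (norm_le_norm_apply_one_add (fderiv ℝ φ x)) (norm_nonneg z)) (norm_nonneg (φ x))
  have h8 : ‖((2 : ℕ) : ℝ)‖ = 2 := by norm_num
  rw [h8]
  linarith

theorem eLpNorm_norm_sq (φ : ℂ → ℂ) (μ : Measure ℂ) :
    eLpNorm (fun x => ‖φ x‖ ^ 2) 2 μ = eLpNorm φ 4 μ ^ (2 : ℝ) := by
  have h := eLpNorm_norm_rpow (p := 2) (μ := μ) φ (q := 2) (by norm_num)
  have h4 : (2 : ENNReal) * ENNReal.ofReal 2 = 4 := by
    rw [ENNReal.ofReal_ofNat]; norm_num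
  rw [h4] at h
  rw [← h]
  simp only [Real.rpow_two]

/-- Pointwise `|∇|φ|²| ≤ 2 |φ| (|∂₁φ| + |∂₂φ|)`, followed by Cauchy–Schwarz. -/
theorem eLpNorm_fderiv_norm_sq_le {φ : ℂ → ℂ} (hφ : ContDiff ℝ ∞ φ) :
    eLpNorm (fderiv ℝ fun x => ‖φ x‖ ^ 2) 1 volume ≤ 2 * (eLpNorm φ 2 volume *
      (eLpNorm (fun x => fderiv ℝ φ x 1) 2 volume
        + eLpNorm (fun x => fderiv ℝ φ x Complex.I) 2 volume)) := by
  have hdc : Continuous (fun x => fderiv ℝ φ x) := hφ.continuous_fderiv (by simp)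
  set N : ℂ → ℝ := fun x => ‖fderiv ℝ φ x 1‖ + ‖fderiv ℝ φ x Complex.I‖ with hN
  have hm1 : AEStronglyMeasurable (fun x => fderiv ℝ φ x 1) (volume : Measure ℂ) :=
    (hdc.clm_apply continuous_const).aestronglyMeasurable
  have hm2 : AEStronglyMeasurable (fun x => fderiv ℝ φ x Complex.I) (volume : Measure ℂ) :=
    (hdc.clm_apply continuous_const).aestronglyMeasurable
  have hmN : AEStronglyMeasurable N (volume : Measure ℂ) := hm1.norm.add hm2.norm
  have h3 : eLpNorm (fderiv ℝ fun x => ‖φ x‖ ^ 2) 1 volume ≤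
      ENNReal.ofReal 2 * eLpNorm (N • φ) 1 volume := by
    refine eLpNorm_le_mul_eLpNorm_of_ae_le_mul (Eventually.of_forall fun x => ?_) 1
    rw [Pi.smul_apply', norm_smul, Real.norm_of_nonneg (by positivity)]
    exact norm_fderiv_norm_sq_le (hφ.differentiable (by simp) x)
  have h4 : eLpNorm (N • φ) 1 volume ≤ eLpNorm N 2 volume * eLpNorm φ 2 volume := by
    have : ENNReal.HolderTriple 2 2 1 := inferInstance
    exact eLpNorm_smul_le_mul_eLpNorm (p := 2) (q := 2) (r := 1)
      hφ.continuous.aestronglyMeasurable hmN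
  have h5 : eLpNorm N 2 volume ≤ eLpNorm (fun x => fderiv ℝ φ x 1) 2 volume
      + eLpNorm (fun x => fderiv ℝ φ x Complex.I) 2 volume := by
    refine (eLpNorm_add_le hm1.norm hm2.norm (by norm_num)).trans ?_
    rw [eLpNorm_norm, eLpNorm_norm]
  rw [ENNReal.ofReal_ofNat] at h3
  refine h3.trans (mul_le_mul_right (h4.trans ?_) _)
  rw [mul_comm]
  exact mul_le_mul_right h5 _

/-- Ladyzhenskaya's inequality for compactly supported fields on the plane. -/
theorem exists_eLpNorm_four_sq_le : ∃ C : NNReal, ∀ φ : ℂ → ℂ, ContDiff ℝ ∞ φ → HasCompactSupport φ →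
    eLpNorm φ 4 volume ^ (2 : ℝ) ≤ C * (eLpNorm φ 2 volume *
      (eLpNorm (fun x => fderiv ℝ φ x 1) 2 volume
        + eLpNorm (fun x => fderiv ℝ φ x Complex.I) 2 volume)) := by
  obtain ⟨K, hK⟩ : ∃ K : NNReal, K = eLpNormLESNormFDerivOneConst (volume : Measure ℂ) (2 : NNReal) :=
    ⟨_, rfl⟩
  refine ⟨K * 2, fun φ hφ hc => ?_⟩
  have hud : ContDiff ℝ 1 (fun x => ‖φ x‖ ^ 2) := (hφ.norm_sq ℝ).of_le (by simp)
  have huc : HasCompactSupport (fun x => ‖φ x‖ ^ 2) :=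
    hc.norm.comp_left (g := fun r : ℝ => r ^ 2) (by simp)
  have hdim : (Module.finrank ℝ ℂ : NNReal).HolderConjugate 2 := by
    rw [Complex.finrank_real_complex]
    exact_mod_cast NNReal.HolderConjugate.two_two
  -- The planar Gagliardo–Nirenberg–Sobolev inequality, from `L¹` of the gradient to `L²`, is
  -- applied to `|φ|²`, whose `L²` norm is the square of the `L⁴` norm of `φ`.
  have h1 := eLpNorm_le_eLpNorm_fderiv_one (volume : Measure ℂ) hud huc hdim
  rw [← hK, ENNReal.coe_ofNat, eLpNorm_norm_sq] at h1
  refine h1.trans ?_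
  rw [ENNReal.coe_mul, ENNReal.coe_ofNat, mul_assoc]
  exact mul_le_mul_right (eLpNorm_fderiv_norm_sq_le hφ) _

variable {Ω : Set ℂ}

theorem IsTestFunction.support_fderiv_apply_subset {E F : Type*} [NormedAddCommGroup E]
    [NormedSpace ℝ E] [NormedAddCommGroup F] [NormedSpace ℝ F] {Ω : Set E} {φ : E → F}
    (hφ : IsTestFunction Ω φ) (e : E) :
    tsupport (fun x => fderiv ℝ φ x e) ⊆ Ω :=
  (tsupport_fderiv_apply_subset ℝ e).trans hφ.tsupport_subset

theorem IsTestFunction.fderiv_apply {E F : Type*} [NormedAddCommGroup E]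
    [NormedSpace ℝ E] [NormedAddCommGroup F] [NormedSpace ℝ F] {Ω : Set E} {φ : E → F}
    (hφ : IsTestFunction Ω φ) (e : E) : IsTestFunction Ω (fun x => fderiv ℝ φ x e) where
  contDiff := (hφ.contDiff.fderiv_right (m := ∞) (by simp)).clm_apply contDiff_const
  hasCompactSupport := hφ.hasCompactSupport.fderiv_apply (𝕜 := ℝ) e
  tsupport_subset := hφ.support_fderiv_apply_subset e

theorem IsTestFunction.add {E F : Type*} [NormedAddCommGroup E]
    [NormedSpace ℝ E] [NormedAddCommGroup F] [NormedSpace ℝ F] {Ω : Set E} {φ ψ : E → F}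
    (hφ : IsTestFunction Ω φ) (hψ : IsTestFunction Ω ψ) : IsTestFunction Ω (φ + ψ) where
  contDiff := hφ.contDiff.add hψ.contDiff
  hasCompactSupport := hφ.hasCompactSupport.add hψ.hasCompactSupport
  tsupport_subset := (tsupport_add φ ψ).trans (union_subset hφ.tsupport_subset hψ.tsupport_subset)

theorem IsTestFunction.const_smul {E F : Type*} [NormedAddCommGroup E]
    [NormedSpace ℝ E] [NormedAddCommGroup F] [NormedSpace ℝ F] {Ω : Set E} {φ : E → F}
    (hφ : IsTestFunction Ω φ) (c : ℝ) : IsTestFunction Ω (c • φ) where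
  contDiff := contDiff_const.smul hφ.contDiff
  hasCompactSupport := hφ.hasCompactSupport.smul_left (f := fun _ => c)
  tsupport_subset := (tsupport_smul_subset_right (fun _ => c) φ).trans hφ.tsupport_subset

theorem solenoidalTest_add {φ ψ : ℂ → ℂ} (hφ : φ ∈ solenoidalTest Ω) (hψ : ψ ∈ solenoidalTest Ω) :
    φ + ψ ∈ solenoidalTest Ω := by
  refine ⟨hφ.1.add hψ.1, fun x => ?_⟩
  have h := fderiv_add (hφ.1.contDiff.differentiable (by simp) x)
    (hψ.1.contDiff.differentiable (by simp) x)
  have h1 := hφ.2 x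
  have h2 := hψ.2 x
  simp only [divergence] at h1 h2 ⊢
  rw [h]
  simp only [_root_.add_apply, Complex.add_re, Complex.add_im]
  linarith

theorem solenoidalTest_smul {φ : ℂ → ℂ} (c : ℝ) (hφ : φ ∈ solenoidalTest Ω) :
    c • φ ∈ solenoidalTest Ω := by
  refine ⟨hφ.1.const_smul c, fun x => ?_⟩
  have h := fderiv_const_smul (hφ.1.contDiff.differentiable (by simp) x) c
  have h1 := hφ.2 x
  simp only [divergence] at h1 ⊢
  rw [h]
  simp only [_root_.smul_apply, Complex.smul_re, Complex.smul_im, smul_eq_mul]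
  linear_combination c * h1

/-- The jet of a field: `F = (φ, ∂₁ φ, ∂₂ φ)` almost everywhere. -/
def IsJetOf (Ω : Set ℂ) (φ : ℂ → ℂ) (F : Jet Ω) : Prop :=
  F 0 =ᵐ[volume.restrict Ω] φ ∧
    F 1 =ᵐ[volume.restrict Ω] (fun x => fderiv ℝ φ x 1) ∧
    F 2 =ᵐ[volume.restrict Ω] (fun x => fderiv ℝ φ x Complex.I)

/-- The space of jets of divergence-free test fields. -/
def testJets (Ω : Set ℂ) : Submodule ℝ (Jet Ω) where
  carrier := {F | ∃ φ ∈ solenoidalTest Ω, IsJetOf Ω φ F}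
  add_mem' := by
    rintro F G ⟨φ, hφ, hF0, hF1, hF2⟩ ⟨ψ, hψ, hG0, hG1, hG2⟩
    have hd : ∀ x, fderiv ℝ (φ + ψ) x = fderiv ℝ φ x + fderiv ℝ ψ x := fun x =>
      fderiv_add (hφ.1.contDiff.differentiable (by simp) x)
        (hψ.1.contDiff.differentiable (by simp) x)
    refine ⟨φ + ψ, solenoidalTest_add hφ hψ, ?_, ?_, ?_⟩
    · filter_upwards [Lp.coeFn_add (F 0) (G 0), hF0, hG0] with x h1 h2 h3
      rw [PiLp.add_apply, h1, Pi.add_apply, h2, h3, Pi.add_apply]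
    · filter_upwards [Lp.coeFn_add (F 1) (G 1), hF1, hG1] with x h1 h2 h3
      rw [PiLp.add_apply, h1, Pi.add_apply, h2, h3, hd, _root_.add_apply]
    · filter_upwards [Lp.coeFn_add (F 2) (G 2), hF2, hG2] with x h1 h2 h3
      rw [PiLp.add_apply, h1, Pi.add_apply, h2, h3, hd, _root_.add_apply]
  zero_mem' := by
    refine ⟨0, ⟨⟨contDiff_const, HasCompactSupport.zero, by simp⟩, fun x => ?_⟩, ?_, ?_, ?_⟩
    · simp [divergence]
    all_goals
      refine (Lp.coeFn_zero ℂ 2 (volume.restrict Ω)).trans (Eventually.of_forall fun x => ?_)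
      simp
  smul_mem' := by
    rintro c F ⟨φ, hφ, hF0, hF1, hF2⟩
    have hd : ∀ x, fderiv ℝ (c • φ) x = c • fderiv ℝ φ x := fun x =>
      fderiv_const_smul (hφ.1.contDiff.differentiable (by simp) x) c
    refine ⟨c • φ, solenoidalTest_smul c hφ, ?_, ?_, ?_⟩
    · filter_upwards [Lp.coeFn_smul c (F 0), hF0] with x h1 h2
      rw [PiLp.smul_apply, h1, Pi.smul_apply, h2, Pi.smul_apply]
    · filter_upwards [Lp.coeFn_smul c (F 1), hF1] with x h1 h2
      rw [PiLp.smul_apply, h1, Pi.smul_apply, h2, hd, _root_.smul_apply]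
    · filter_upwards [Lp.coeFn_smul c (F 2), hF2] with x h1 h2
      rw [PiLp.smul_apply, h1, Pi.smul_apply, h2, hd, _root_.smul_apply]

theorem spaceV_subset : spaceV Ω ⊆ (testJets Ω).topologicalClosure := inter_subset_right

/-- Ladyzhenskaya's inequality on `𝓥(Ω)`. -/
theorem exists_eLpNorm_four_le (Ω : Set ℂ) : ∃ C : NNReal, ∀ F ∈ (testJets Ω).topologicalClosure,
    eLpNorm (F 0) 4 (volume.restrict Ω) ≤
      ENNReal.ofReal (C * (‖F 0‖ * (‖F 1‖ + ‖F 2‖))) ^ (1 / 2 : ℝ) := by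
  obtain ⟨C, hC⟩ := exists_eLpNorm_four_sq_le
  have hnorm : ∀ (f : L2 Ω) (g : ℂ → ℂ), f =ᵐ[volume.restrict Ω] g → tsupport g ⊆ Ω →
      eLpNorm g 2 volume = ENNReal.ofReal ‖f‖ := by
    intro f g hfg hg
    rw [Lp.norm_def, ENNReal.ofReal_toReal (Lp.eLpNorm_ne_top f), eLpNorm_congr_ae hfg,
      eLpNorm_restrict_eq_of_support_subset ((subset_tsupport g).trans hg)]
  have htest : ∀ F ∈ testJets Ω, eLpNorm (F 0) 4 (volume.restrict Ω) ≤
      ENNReal.ofReal (C * (‖F 0‖ * (‖F 1‖ + ‖F 2‖))) ^ (1 / 2 : ℝ) := by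
    rintro F ⟨φ, hφ, hF0, hF1, hF2⟩
    have h := hC φ hφ.1.contDiff hφ.1.hasCompactSupport
    rw [hnorm _ _ hF0 hφ.1.tsupport_subset, hnorm _ _ hF1 (hφ.1.support_fderiv_apply_subset _),
      hnorm _ _ hF2 (hφ.1.support_fderiv_apply_subset _),
      ← ENNReal.ofReal_add (norm_nonneg _) (norm_nonneg _),
      ← ENNReal.ofReal_mul (norm_nonneg _), ← ENNReal.ofReal_coe_nnreal,
      ← ENNReal.ofReal_mul C.coe_nonneg] at h
    rw [eLpNorm_congr_ae hF0]
    refine (eLpNorm_mono_measure φ Measure.restrict_le_self).trans ?_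
    have h2 := ENNReal.rpow_le_rpow h (show (0 : ℝ) ≤ 1 / 2 by norm_num)
    rwa [← ENNReal.rpow_mul, mul_one_div_cancel two_ne_zero, ENNReal.rpow_one] at h2
  refine ⟨C, fun F hF => ?_⟩
  obtain ⟨F', hF', hlim⟩ := mem_closure_iff_seq_limit.1 hF
  have hcoord : ∀ i, Tendsto (fun n => F' n i) atTop (𝓝 (F i)) := fun i =>
    ((PiLp.continuous_apply 2 _ i).tendsto F).comp hlim
  -- Passage to the closure by Fatou: the `L⁴` norm is lower semicontinuous along an almost
  -- everywhere convergent subsequence, and the right side is continuous in the jet.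
  obtain ⟨ns, hns, hae⟩ := (tendstoInMeasure_of_tendsto_Lp (hcoord 0)).exists_seq_tendsto_ae
  have h1 := Lp.eLpNorm_lim_le_liminf_eLpNorm (p := 4)
    (fun n => Lp.aestronglyMeasurable (F' (ns n) 0)) (F 0) hae
  refine h1.trans ?_
  have h2 : Tendsto (fun n => ENNReal.ofReal (C * (‖F' (ns n) 0‖ * (‖F' (ns n) 1‖ + ‖F' (ns n) 2‖)))
      ^ (1 / 2 : ℝ)) atTop (𝓝 (ENNReal.ofReal (C * (‖F 0‖ * (‖F 1‖ + ‖F 2‖))) ^ (1 / 2 : ℝ))) := by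
    refine (ENNReal.continuous_rpow_const.tendsto _).comp
      ((ENNReal.continuous_ofReal.tendsto _).comp ?_)
    have h3 : ∀ i, Tendsto (fun n => ‖F' (ns n) i‖) atTop (𝓝 ‖F i‖) := fun i =>
      ((hcoord i).comp hns.tendsto_atTop).norm
    exact ((h3 0).mul ((h3 1).add (h3 2))).const_mul _
  rw [← h2.liminf_eq]
  exact liminf_le_liminf (Eventually.of_forall fun n => htest _ (hF' (ns n)))

/-- The embedding of `𝓥(Ω)` into `L⁴(Ω)`, extended to all jets by orthogonal projection. -/
theorem exists_embedding_L4 (Ω : Set ℂ) :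
    ∃ (C : ℝ) (e : Jet Ω →L[ℝ] Lp ℂ 4 (volume.restrict Ω)), 0 ≤ C ∧
      ∀ F ∈ (testJets Ω).topologicalClosure,
        e F =ᵐ[volume.restrict Ω] F 0 ∧ ‖e F‖ ^ 2 ≤ C * (‖F 0‖ * (‖F 1‖ + ‖F 2‖)) := by
  obtain ⟨C, hC⟩ := exists_eLpNorm_four_le Ω
  set V := (testJets Ω).topologicalClosure with hV
  have hmem : ∀ F : V, MemLp ((F : Jet Ω) 0) 4 (volume.restrict Ω) := fun F =>
    ⟨Lp.aestronglyMeasurable _, (hC F F.2).trans_lt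
      (ENNReal.rpow_lt_top_of_nonneg (by norm_num) ENNReal.ofReal_ne_top)⟩
  let e₀ : V →ₗ[ℝ] Lp ℂ 4 (volume.restrict Ω) :=
    { toFun := fun F => (hmem F).toLp _
      map_add' := fun F G => by
        rw [← MemLp.toLp_add]
        exact MemLp.toLp_congr _ _ (Lp.coeFn_add _ _)
      map_smul' := fun c F => by
        rw [RingHom.id_apply, ← MemLp.toLp_const_smul]
        exact MemLp.toLp_congr _ _ (Lp.coeFn_smul _ _) }
  have hsq : ∀ F : V, ‖e₀ F‖ ^ 2 ≤
      C * (‖(F : Jet Ω) 0‖ * (‖(F : Jet Ω) 1‖ + ‖(F : Jet Ω) 2‖)) := by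
    intro F
    have h0 : 0 ≤ C * (‖(F : Jet Ω) 0‖ * (‖(F : Jet Ω) 1‖ + ‖(F : Jet Ω) 2‖)) := by positivity
    have h1 : ‖e₀ F‖ ≤ (C * (‖(F : Jet Ω) 0‖ * (‖(F : Jet Ω) 1‖ + ‖(F : Jet Ω) 2‖))) ^ (1 / 2 : ℝ) := by
      change ‖(hmem F).toLp _‖ ≤ _
      rw [Lp.norm_toLp]
      refine ENNReal.toReal_le_of_le_ofReal (by positivity) ?_
      rw [← ENNReal.ofReal_rpow_of_nonneg h0 (by norm_num)]
      exact hC F F.2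
    rw [← Real.sqrt_eq_rpow] at h1
    exact (Real.le_sqrt (norm_nonneg _) h0).1 h1
  have hbd : ∀ F : V, ‖e₀ F‖ ≤ Real.sqrt (2 * C) * ‖F‖ := by
    intro F
    have hi : ∀ i, ‖(F : Jet Ω) i‖ ≤ ‖F‖ := fun i => PiLp.norm_apply_le (F : Jet Ω) i
    rw [← Real.sqrt_sq (norm_nonneg F), ← Real.sqrt_mul (by positivity)]
    refine Real.le_sqrt_of_sq_le ((hsq F).trans ?_)
    have : ‖(F : Jet Ω) 0‖ * (‖(F : Jet Ω) 1‖ + ‖(F : Jet Ω) 2‖) ≤ ‖F‖ * (‖F‖ + ‖F‖) := by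
      gcongr
      exacts [hi 0, hi 1, hi 2]
    nlinarith [C.coe_nonneg]
  let e₁ : V →L[ℝ] Lp ℂ 4 (volume.restrict Ω) := e₀.mkContinuous _ hbd
  -- The projection makes `e` defined and continuous on all jets, so that composing it with a
  -- measurable curve, in `𝓥` only almost everywhere, raises no measurability question.
  refine ⟨C, e₁ ∘L V.orthogonalProjectionOnto, C.coe_nonneg, fun F hF => ?_⟩
  have hproj : V.orthogonalProjectionOnto F = ⟨F, hF⟩ :=
    Submodule.orthogonalProjectionOnto_mem_subspace_eq_self (⟨F, hF⟩ : V)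
  rw [ContinuousLinearMap.comp_apply, hproj]
  exact ⟨(hmem ⟨F, hF⟩).coeFn_toLp, hsq ⟨F, hF⟩⟩

end Ladyzhenskaya

/-! ### The momentum equation integrated in time, and integration by parts in space. -/

section WeakFormulation

variable {Ω : Set ℂ} {v : ℂ → ℂ} {φ : ℂ → ℂ}

theorem IsTestFunction.memLp {F : Type*} [NormedAddCommGroup F] [NormedSpace ℝ F] {φ : ℂ → F}
    (hφ : IsTestFunction Ω φ) (p : ENNReal) : MemLp φ p (volume.restrict Ω) :=
  (hφ.contDiff.continuous.memLp_of_hasCompactSupport hφ.hasCompactSupport).restrict Ω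

theorem IsTestFunction.total_fderiv {E F : Type*} [NormedAddCommGroup E]
    [NormedSpace ℝ E] [NormedAddCommGroup F] [NormedSpace ℝ F] {Ω : Set E} {φ : E → F}
    (hφ : IsTestFunction Ω φ) : IsTestFunction Ω (fderiv ℝ φ) where
  contDiff := hφ.contDiff.fderiv_right (m := ∞) (by simp)
  hasCompactSupport := hφ.hasCompactSupport.fderiv (𝕜 := ℝ)
  tsupport_subset := (tsupport_fderiv_subset ℝ).trans hφ.tsupport_subset

theorem laplacian_eq_fderiv_fderiv (hφ : ContDiff ℝ ∞ φ) (x : ℂ) :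
    Laplacian.laplacian φ x = fderiv ℝ (fun y => fderiv ℝ φ y 1) x 1
      + fderiv ℝ (fun y => fderiv ℝ φ y Complex.I) x Complex.I := by
  have hd : DifferentiableAt ℝ (fderiv ℝ φ) x :=
    (hφ.fderiv_right (m := ∞) (by simp)).differentiable (by simp) x
  have h (e : ℂ) : fderiv ℝ (fun y => fderiv ℝ φ y e) x e = iteratedFDeriv ℝ 2 φ x ![e, e] := by
    rw [iteratedFDeriv_two_apply, fderiv_clm_apply hd (differentiableAt_const e)]
    simp
  rw [InnerProductSpace.laplacian_eq_iteratedFDeriv_complexPlane, h, h]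

theorem IsTestFunction.laplacian (hφ : IsTestFunction Ω φ) :
    IsTestFunction Ω (Laplacian.laplacian φ) := by
  have h : Laplacian.laplacian φ = (fun x => fderiv ℝ (fun y => fderiv ℝ φ y 1) x 1)
      + (fun x => fderiv ℝ (fun y => fderiv ℝ φ y Complex.I) x Complex.I) :=
    funext fun x => laplacian_eq_fderiv_fderiv hφ.contDiff x
  rw [h]
  exact ((hφ.fderiv_apply 1).fderiv_apply 1).add
    ((hφ.fderiv_apply Complex.I).fderiv_apply Complex.I)

/-- The weak form of the momentum flux and of the viscous term, tested with `φ`. -/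
noncomputable def momentumFlux (Ω : Set ℂ) (ν : ℝ) (φ u : ℂ → ℂ) : ℝ :=
  ∫ x in Ω, ((inner ℝ (fderiv ℝ φ x (u x)) (u x) : ℝ)
    + ν * inner ℝ (u x) (Laplacian.laplacian φ x))

theorem laplacian_eq_zero_of_notMem_tsupport (hφ : ContDiff ℝ ∞ φ) {x : ℂ} (hx : x ∉ tsupport φ) :
    Laplacian.laplacian φ x = 0 := by
  rw [laplacian_eq_fderiv_fderiv hφ]
  have h (e : ℂ) : fderiv ℝ (fun y => fderiv ℝ φ y e) x = 0 := by
    by_contra h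
    exact hx ((tsupport_fderiv_apply_subset ℝ e)
      (support_fderiv_subset (𝕜 := ℝ) (Function.mem_support.2 h)))
  rw [h, h]; simp

/-- The pairings of a field `u` with a test field are continuous functions of `u - v` in `L²`. -/
theorem exists_continuous_pairings (hv : MemLp v ⊤ (volume.restrict Ω)) (hφ : IsTestFunction Ω φ)
    (ν : ℝ) :
    ∃ a b : L2 Ω → ℝ, Continuous a ∧ Continuous b ∧ ∀ (w : L2 Ω) (u : ℂ → ℂ),
      w =ᵐ[volume.restrict Ω] (fun x => u x - v x) →
      Integrable (fun x => (inner ℝ (u x) (φ x) : ℝ)) (volume.restrict Ω) ∧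
      Integrable (fun x => (inner ℝ (fderiv ℝ φ x (u x)) (u x) : ℝ)
        + ν * inner ℝ (u x) (Laplacian.laplacian φ x)) (volume.restrict Ω) ∧
      ∫ x in Ω, (inner ℝ (u x) (φ x) : ℝ) = a w ∧ momentumFlux Ω ν φ u = b w := by
  set K := tsupport φ with hK
  have hKc : IsCompact K := hφ.hasCompactSupport
  have hKm : MeasurableSet K := hKc.measurableSet
  -- The bounded field `v` need not be square integrable; cut off to the compact support of `φ` it
  -- is, and no pairing sees the rest.
  have hvK : MemLp (K.indicator v) 2 (volume.restrict Ω) := by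
    rw [memLp_indicator_iff_restrict hKm]
    have : IsFiniteMeasure ((volume.restrict Ω).restrict K) :=
      isFiniteMeasure_restrict.2 ((Measure.restrict_apply_le _ _).trans_lt hKc.measure_lt_top).ne
    exact (hv.restrict K).mono_exponent le_top
  set vK : L2 Ω := hvK.toLp _ with hvK'
  set φ₀ : L2 Ω := (hφ.memLp 2).toLp _ with hφ₀
  set Δφ : L2 Ω := (hφ.laplacian.memLp 2).toLp _ with hΔφ
  -- Multiplication by the bounded field `Dφ` is a bounded operator on `L²`, so the convective term
  -- is a continuous quadratic form.
  set D : Lp (ℂ →L[ℝ] ℂ) ⊤ (volume.restrict Ω) := (hφ.total_fderiv.memLp ⊤).toLp _ with hD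
  set M : L2 Ω →L[ℝ] L2 Ω :=
    (ContinuousLinearMap.id ℝ (ℂ →L[ℝ] ℂ)).holderL (volume.restrict Ω) ⊤ 2 2 D with hM
  refine ⟨fun w => inner ℝ (w + vK) φ₀,
    fun w => inner ℝ (M (w + vK)) (w + vK) + ν * inner ℝ (w + vK) Δφ,
    by fun_prop, by fun_prop, fun w u hwu => ?_⟩
  set U : L2 Ω := w + vK with hU
  have hUu : ∀ᵐ x ∂volume.restrict Ω, x ∈ K → U x = u x := by
    filter_upwards [Lp.coeFn_add w vK, hwu, hvK.coeFn_toLp] with x h1 h2 h3 hx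
    rw [hU, h1, Pi.add_apply, h2, hvK', h3, indicator_of_mem hx, sub_add_cancel]
  have e1 : (fun x => (inner ℝ (U x) (φ₀ x) : ℝ)) =ᵐ[volume.restrict Ω]
      fun x => inner ℝ (u x) (φ x) := by
    filter_upwards [hUu, (hφ.memLp (Ω := Ω) 2).coeFn_toLp] with x h1 h2
    rw [hφ₀, h2]
    by_cases hx : x ∈ K
    · rw [h1 hx]
    · rw [image_eq_zero_of_notMem_tsupport hx, inner_zero_right, inner_zero_right]
  have e2 : (fun x => (inner ℝ (M U x) (U x) : ℝ)) =ᵐ[volume.restrict Ω]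
      fun x => inner ℝ (fderiv ℝ φ x (u x)) (u x) := by
    filter_upwards [hUu, (hφ.total_fderiv.memLp (Ω := Ω) ⊤).coeFn_toLp,
      (ContinuousLinearMap.id ℝ (ℂ →L[ℝ] ℂ)).coeFn_holder (r := 2) D U] with x h1 h2 h3
    rw [hM, ContinuousLinearMap.holderL_apply_apply, h3, hD, h2]
    by_cases hx : x ∈ K
    · rw [h1 hx, ContinuousLinearMap.id_apply]
    · have : fderiv ℝ φ x = 0 := by
        by_contra h
        exact hx (support_fderiv_subset (𝕜 := ℝ) (Function.mem_support.2 h))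
      rw [this]; simp
  have e3 : (fun x => (inner ℝ (U x) (Δφ x) : ℝ)) =ᵐ[volume.restrict Ω]
      fun x => inner ℝ (u x) (Laplacian.laplacian φ x) := by
    filter_upwards [hUu, (hφ.laplacian.memLp (Ω := Ω) 2).coeFn_toLp] with x h1 h2
    rw [hΔφ, h2]
    by_cases hx : x ∈ K
    · rw [h1 hx]
    · rw [laplacian_eq_zero_of_notMem_tsupport hφ.contDiff hx, inner_zero_right, inner_zero_right]
  have i1 := (integrable_congr e1).1 (L2.integrable_inner (𝕜 := ℝ) U φ₀)
  have i2 := (integrable_congr e2).1 (L2.integrable_inner (𝕜 := ℝ) (M U) U)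
  have i3 := (integrable_congr e3).1 (L2.integrable_inner (𝕜 := ℝ) U Δφ)
  refine ⟨i1, i2.add (i3.const_mul ν), ?_, ?_⟩
  · change _ = (inner ℝ U φ₀ : ℝ)
    rw [L2.inner_def, integral_congr_ae e1]
  · change _ = (inner ℝ (M U) U : ℝ) + ν * inner ℝ U Δφ
    rw [momentumFlux, integral_add i2 (i3.const_mul ν), integral_const_mul, L2.inner_def,
      L2.inner_def, integral_congr_ae e2, integral_congr_ae e3]

theorem IsTestFunction.smul_prod {θ : ℝ → ℝ} {I : Set ℝ} (hθ : IsTestFunction I θ)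
    (hφ : IsTestFunction Ω φ) : IsTestFunction (I ×ˢ Ω) (fun p : ℝ × ℂ => θ p.1 • φ p.2) := by
  have hs : tsupport (fun p : ℝ × ℂ => θ p.1 • φ p.2) ⊆ tsupport θ ×ˢ tsupport φ := by
    refine closure_minimal (fun p hp => ?_) ((isClosed_tsupport θ).prod (isClosed_tsupport φ))
    have h := smul_ne_zero_iff.1 (Function.mem_support.1 hp)
    exact ⟨subset_tsupport _ h.1, subset_tsupport _ h.2⟩
  refine ⟨?_, ?_, hs.trans (prod_mono hθ.tsupport_subset hφ.tsupport_subset)⟩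
  · exact (hθ.contDiff.comp contDiff_fst).smul (hφ.contDiff.comp contDiff_snd)
  · exact (hθ.hasCompactSupport.isCompact.prod hφ.hasCompactSupport.isCompact).of_isClosed_subset
      (isClosed_tsupport _) hs

/-- The momentum equation in integrated form, tested with time-independent fields. -/
theorem IsWeakSolution.pairing_eq {ν : ℝ} {u₀ : ℂ → ℂ} {u : ℝ → ℂ → ℂ}
    (hu : IsWeakSolution Ω ν v u₀ u) (hv : MemLp v ⊤ (volume.restrict Ω))
    {w : ℝ → L2 Ω} (hw : ContinuousOn w (Ici 0))
    (hwu : ∀ t, 0 ≤ t → w t =ᵐ[volume.restrict Ω] fun x => u t x - v x)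
    (hφ : φ ∈ solenoidalTest Ω) {t : ℝ} (ht : 0 ≤ t) :
    ContinuousOn (fun s => momentumFlux Ω ν φ (u s)) (Ici 0) ∧
    ∫ x in Ω, (inner ℝ (u t x) (φ x) : ℝ) = (∫ x in Ω, (inner ℝ (u₀ x) (φ x) : ℝ))
      + ∫ s in (0 : ℝ)..t, momentumFlux Ω ν φ (u s) := by
  obtain ⟨a, b, ha, hb, hab⟩ := exists_continuous_pairings hv hφ.1 ν
  set f : ℝ → ℝ := fun t => ∫ x in Ω, (inner ℝ (u t x) (φ x) : ℝ) with hf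
  have hfa : ∀ s ∈ Ici (0 : ℝ), f s = a (w s) := fun s hs => (hab _ _ (hwu s hs)).2.2.1
  have hGb : ∀ s ∈ Ici (0 : ℝ), momentumFlux Ω ν φ (u s) = b (w s) := fun s hs =>
    (hab _ _ (hwu s hs)).2.2.2
  have hfc : ContinuousOn f (Ici 0) := (ha.comp_continuousOn hw).congr hfa
  have hGc : ContinuousOn (fun s => momentumFlux Ω ν φ (u s)) (Ici 0) :=
    (hb.comp_continuousOn hw).congr hGb
  refine ⟨hGc, ?_⟩
  have key : ∀ θ : ℝ → ℝ, IsTestFunction (Ioi 0) θ →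
      ∫ t in Ioi (0 : ℝ), (deriv θ t * f t + θ t * momentumFlux Ω ν φ (u t)) = 0 := by
    intro θ hθ
    have hdφ : ∀ x, DifferentiableAt ℝ φ x := hφ.1.contDiff.differentiable (by simp)
    -- Separated test fields `θ(t) φ(x)` reduce the equation to a scalar one in time.
    have h := hu.momentum _ (hθ.smul_prod hφ.1) fun t x => by
      have h1 := hφ.2 x
      simp only [divergence] at h1 ⊢
      rw [fderiv_fun_const_smul (hdφ x), _root_.smul_apply, _root_.smul_apply, Complex.smul_re,
        Complex.smul_im, smul_eq_mul, smul_eq_mul]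
      linear_combination θ t * h1
    refine Eq.trans ?_ h
    refine setIntegral_congr_fun measurableSet_Ioi fun t ht => ?_
    obtain ⟨i1, i2, -, -⟩ := hab _ _ (hwu t (le_of_lt ht))
    simp only [hf, momentumFlux]
    rw [← integral_const_mul, ← integral_const_mul,
      ← integral_add (i1.const_mul _) (i2.const_mul _)]
    refine integral_congr_ae (Eventually.of_forall fun x => ?_)
    have h1 : deriv (fun s => θ s • φ x) t = deriv θ t • φ x :=
      deriv_smul_const (hθ.contDiff.differentiable (by simp) t) _
    have h2 : Laplacian.laplacian (fun y => θ t • φ y) x = θ t • Laplacian.laplacian φ x :=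
      InnerProductSpace.laplacian_smul (θ t) (by exact_mod_cast (contDiff_infty.1 hφ.1.contDiff 2).contDiffAt)
    have h3 : fderiv ℝ (fun y => θ t • φ y) x = θ t • fderiv ℝ φ x :=
      fderiv_fun_const_smul (hdφ x) _
    simp only [h1, h2, h3, _root_.smul_apply, inner_smul_left, inner_smul_right, conj_trivial]
    ring
  have h1 := sub_eq_integral_of_weak_deriv hfc hGc key ht
  have h2 : f 0 = ∫ x in Ω, (inner ℝ (u₀ x) (φ x) : ℝ) :=
    tendsto_nhds_unique ((hfc 0 self_mem_Ici).tendsto.mono_left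
      (nhdsWithin_mono 0 Ioi_subset_Ici_self)) (hu.initial φ hφ.1)
  rw [← h2, ← h1]
  ring

/-- Integration by parts against a test field. -/
theorem HasWeakDeriv.integral_inner_fderiv {e : ℂ} {f g : L2 Ω} (h : HasWeakDeriv Ω e f g)
    {η : ℂ → ℂ} (hη : IsTestFunction Ω η) :
    ∫ x in Ω, (inner ℝ (f x) (fderiv ℝ η x e) : ℝ) = - ∫ x in Ω, (inner ℝ (g x) (η x) : ℝ) := by
  have hcomp : ∀ L : ℂ →L[ℝ] ℝ, IsTestFunction Ω (fun x => L (η x)) := fun L =>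
    ⟨L.contDiff.comp hη.contDiff, hη.hasCompactSupport.comp_left (g := L) (map_zero L),
      (tsupport_comp_subset (map_zero L) η).trans hη.tsupport_subset⟩
  have hd : ∀ (L : ℂ →L[ℝ] ℝ) (x : ℂ), fderiv ℝ (fun x => L (η x)) x e = L (fderiv ℝ η x e) := by
    intro L x
    have := L.hasFDerivAt.comp x (hη.contDiff.differentiable (by simp) x).hasFDerivAt
    rw [HasFDerivAt.fderiv (f := fun x => L (η x)) this, ContinuousLinearMap.comp_apply]
  have hmul : ∀ (L : ℂ →L[ℝ] ℝ) (k : L2 Ω) (ζ : ℂ → ℂ), IsTestFunction Ω ζ →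
      Integrable (fun x => L (ζ x) • k x) (volume.restrict Ω) := by
    intro L k ζ hζ
    have h1 : MemLp (fun x => L (ζ x)) 2 (volume.restrict Ω) := L.comp_memLp' (hζ.memLp 2)
    exact memLp_one_iff_integrable.1 ((Lp.memLp k).smul h1)
  have hre := h _ (hcomp Complex.reCLM)
  have him := h _ (hcomp Complex.imCLM)
  simp only [hd] at hre him
  have hη' := hη.fderiv_apply e
  have hr := congrArg Complex.reCLM hre
  have hi := congrArg Complex.imCLM him
  rw [map_neg] at hr hi
  rw [← ContinuousLinearMap.integral_comp_comm _ (hmul _ _ _ hη'),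
    ← ContinuousLinearMap.integral_comp_comm _ (hmul _ _ _ hη)] at hr hi
  -- Weak derivatives are tested with scalar functions, so the inner product is split as `Re (Re ζ ·
  -- k) + Im (Im ζ · k)`.
  have hs : ∀ (k : L2 Ω) (ζ : ℂ → ℂ), IsTestFunction Ω ζ →
      ∫ x in Ω, (inner ℝ (k x) (ζ x) : ℝ) =
      (∫ x in Ω, Complex.reCLM (Complex.reCLM (ζ x) • k x))
        + ∫ x in Ω, Complex.imCLM (Complex.imCLM (ζ x) • k x) := by
    intro k ζ hζ
    rw [← integral_add (Complex.reCLM.integrable_comp (hmul _ _ _ hζ))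
      (Complex.imCLM.integrable_comp (hmul _ _ _ hζ))]
    refine integral_congr_ae (Eventually.of_forall fun x => ?_)
    simp [Complex.inner, Complex.mul_re]
  rw [hs _ _ hη', hs _ _ hη, hr, hi]
  ring

end WeakFormulation

/-! ### The flux difference as an element of `L²(Ω)³`. -/

section Flux

instance holderTriple_four_four_two : ENNReal.HolderTriple 4 4 2 where
  inv_add_inv_eq_inv := by
    rw [← two_mul, show (4 : ENNReal) = 2 * 2 by norm_num, ENNReal.mul_inv (by simp) (by simp),
      ← mul_assoc, ENNReal.mul_inv_cancel (by simp) (by simp), one_mul]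

variable {Ω : Set ℂ} {v : ℂ → ℂ} {φ : ℂ → ℂ}

/-- The bilinear map `(z, u) ↦ L z • u`. -/
noncomputable def scaleBy (L : ℂ →L[ℝ] ℝ) : ℂ →L[ℝ] ℂ →L[ℝ] ℂ :=
  (ContinuousLinearMap.lsmul ℝ ℝ : ℝ →L[ℝ] ℂ →L[ℝ] ℂ).comp L

theorem scaleBy_apply (L : ℂ →L[ℝ] ℝ) (z u : ℂ) : scaleBy L z u = L z • u := rfl

theorem norm_scaleBy_le {L : ℂ →L[ℝ] ℝ} (hL : ‖L‖ ≤ 1) : ‖scaleBy L‖ ≤ 1 := by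
  refine ContinuousLinearMap.opNorm_le_bound₂ _ zero_le_one fun z u => ?_
  rw [scaleBy_apply, norm_smul, one_mul]
  gcongr
  simpa using (L.le_opNorm z).trans (mul_le_mul_of_nonneg_right hL (norm_nonneg z))

/-- With `w = F₁ - F₂`, the product `L(w) (F₁ + v) + L(F₂ + v) w`, as an element of `L²`. -/
noncomputable def crossFlux (L : ℂ →L[ℝ] ℝ) (e : Jet Ω →L[ℝ] Lp ℂ 4 (volume.restrict Ω))
    (V : Lp ℂ ⊤ (volume.restrict Ω)) (F₁ F₂ : Jet Ω) : L2 Ω :=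
  ((scaleBy L).holderL (volume.restrict Ω) 4 4 2 (e (F₁ - F₂)) (e F₁)
    + (scaleBy L).holderL (volume.restrict Ω) 2 ⊤ 2 ((F₁ - F₂) 0) V)
  + ((scaleBy L).holderL (volume.restrict Ω) 4 4 2 (e F₂) (e (F₁ - F₂))
    + (scaleBy L).holderL (volume.restrict Ω) ⊤ 2 2 V ((F₁ - F₂) 0))

variable {L : ℂ →L[ℝ] ℝ} {e : Jet Ω →L[ℝ] Lp ℂ 4 (volume.restrict Ω)}
  {V : Lp ℂ ⊤ (volume.restrict Ω)}

theorem continuous_crossFlux :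
    Continuous fun p : Jet Ω × Jet Ω => crossFlux L e V p.1 p.2 := by
  unfold crossFlux
  have h0 : Continuous fun p : Jet Ω × Jet Ω => (p.1 - p.2) 0 :=
    (PiLp.continuous_apply 2 _ 0).comp (continuous_fst.sub continuous_snd)
  have h1 : Continuous fun p : Jet Ω × Jet Ω => e (p.1 - p.2) := by fun_prop
  have h2 : Continuous fun p : Jet Ω × Jet Ω => e p.1 := by fun_prop
  have h3 : Continuous fun p : Jet Ω × Jet Ω => e p.2 := by fun_prop
  refine (Continuous.add ?_ ?_).add (Continuous.add ?_ ?_)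
  · exact ((ContinuousLinearMap.continuous _).comp h1).clm_apply h2
  · exact ((ContinuousLinearMap.continuous _).comp h0).clm_apply continuous_const
  · exact ((ContinuousLinearMap.continuous _).comp h3).clm_apply h1
  · exact (ContinuousLinearMap.continuous _).comp h0

theorem norm_crossFlux_le (hL : ‖L‖ ≤ 1) (F₁ F₂ : Jet Ω) :
    ‖crossFlux L e V F₁ F₂‖ ≤
      ‖e (F₁ - F₂)‖ * (‖e F₁‖ + ‖e F₂‖) + 2 * ‖V‖ * ‖(F₁ - F₂) 0‖ := by
  have hB := norm_scaleBy_le hL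
  have h1 := (scaleBy L).norm_holder_apply_apply_le (r := 2) (e (F₁ - F₂)) (e F₁)
  have h2 := (scaleBy L).norm_holder_apply_apply_le (r := 2) ((F₁ - F₂) 0) V
  have h3 := (scaleBy L).norm_holder_apply_apply_le (r := 2) (e F₂) (e (F₁ - F₂))
  have h4 := (scaleBy L).norm_holder_apply_apply_le (r := 2) V ((F₁ - F₂) 0)
  have hle : ∀ a b : ℝ, 0 ≤ a → 0 ≤ b → ‖scaleBy L‖ * a * b ≤ a * b := fun a b ha hb => by
    have := mul_le_mul_of_nonneg_right hB (mul_nonneg ha hb)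
    linarith
  replace h1 := h1.trans (hle _ _ (norm_nonneg _) (norm_nonneg _))
  replace h2 := h2.trans (hle _ _ (norm_nonneg _) (norm_nonneg _))
  replace h3 := h3.trans (hle _ _ (norm_nonneg _) (norm_nonneg _))
  replace h4 := h4.trans (hle _ _ (norm_nonneg _) (norm_nonneg _))
  refine (norm_add_le _ _).trans ((add_le_add (norm_add_le _ _) (norm_add_le _ _)).trans ?_)
  simp only [ContinuousLinearMap.holderL_apply_apply]
  linarith

/-- The definition goes through bounded bilinear maps, which yield continuity and norm bounds on all
jets; its pointwise meaning needs `e` to act as the identity on `F₁` and `F₂`. -/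
theorem coeFn_crossFlux {F₁ F₂ : Jet Ω} (h₁ : e F₁ =ᵐ[volume.restrict Ω] F₁ 0)
    (h₂ : e F₂ =ᵐ[volume.restrict Ω] F₂ 0) (hV : V =ᵐ[volume.restrict Ω] v) :
    crossFlux L e V F₁ F₂ =ᵐ[volume.restrict Ω] fun x =>
      L (F₁ 0 x - F₂ 0 x) • (F₁ 0 x + v x) + L (F₂ 0 x + v x) • (F₁ 0 x - F₂ 0 x) := by
  filter_upwards [h₁, h₂, hV, Lp.coeFn_sub (F₁ 0) (F₂ 0), Lp.coeFn_sub (e F₁) (e F₂),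
    (scaleBy L).coeFn_holder (r := 2) (e (F₁ - F₂)) (e F₁),
    (scaleBy L).coeFn_holder (r := 2) ((F₁ - F₂) 0) V,
    (scaleBy L).coeFn_holder (r := 2) (e F₂) (e (F₁ - F₂)),
    (scaleBy L).coeFn_holder (r := 2) V ((F₁ - F₂) 0),
    Lp.coeFn_add ((scaleBy L).holder 2 (e (F₁ - F₂)) (e F₁))
      ((scaleBy L).holder 2 ((F₁ - F₂) 0) V),
    Lp.coeFn_add ((scaleBy L).holder 2 (e F₂) (e (F₁ - F₂)))
      ((scaleBy L).holder 2 V ((F₁ - F₂) 0)),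
    Lp.coeFn_add ((scaleBy L).holder 2 (e (F₁ - F₂)) (e F₁)
      + (scaleBy L).holder 2 ((F₁ - F₂) 0) V) ((scaleBy L).holder 2 (e F₂) (e (F₁ - F₂))
      + (scaleBy L).holder 2 V ((F₁ - F₂) 0))]
    with x a1 a2 a3 a4 a5 a6 a7 a8 a9 b1 b2 b3
  have hs0 : ((F₁ - F₂) 0) x = F₁ 0 x - F₂ 0 x := a4
  have hse : (e (F₁ - F₂)) x = F₁ 0 x - F₂ 0 x := by
    rw [map_sub, a5, Pi.sub_apply, a1, a2]
  simp only [crossFlux, ContinuousLinearMap.holderL_apply_apply]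
  rw [b3, Pi.add_apply, b1, b2, Pi.add_apply, Pi.add_apply, a6, a7, a8, a9]
  simp only [scaleBy_apply]
  rw [hs0, hse, a1, a2, a3, map_add, add_smul, smul_add]

/-- The jet `(0, g₁ - ν ∂₁ w, g₂ - ν ∂₂ w)`, with which the time derivative of `w = F₁ - F₂` is
represented; `g₁`, `g₂` are the components of the flux. -/
noncomputable def forcing (ν : ℝ) (e : Jet Ω →L[ℝ] Lp ℂ 4 (volume.restrict Ω))
    (V : Lp ℂ ⊤ (volume.restrict Ω)) (F₁ F₂ : Jet Ω) : Jet Ω :=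
  WithLp.toLp 2 ![0, crossFlux Complex.reCLM e V F₁ F₂ - ν • (F₁ - F₂) 1,
    crossFlux Complex.imCLM e V F₁ F₂ - ν • (F₁ - F₂) 2]

theorem continuous_forcing (ν : ℝ) :
    Continuous fun p : Jet Ω × Jet Ω => forcing ν e V p.1 p.2 := by
  have h : ∀ i, Continuous fun p : Jet Ω × Jet Ω => (p.1 - p.2) i := fun i =>
    (PiLp.continuous_apply 2 _ i).comp (continuous_fst.sub continuous_snd)
  refine (PiLp.continuous_toLp 2 _).comp (continuous_pi fun i => ?_)
  fin_cases i
  · exact continuous_const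
  · exact continuous_crossFlux.sub ((h 1).const_smul ν)
  · exact continuous_crossFlux.sub ((h 2).const_smul ν)

theorem inner_forcing (ν : ℝ) (F₁ F₂ G : Jet Ω) : (inner ℝ (forcing ν e V F₁ F₂) G : ℝ) =
    inner ℝ (crossFlux Complex.reCLM e V F₁ F₂) (G 1)
      + inner ℝ (crossFlux Complex.imCLM e V F₁ F₂) (G 2)
      - ν * (inner ℝ ((F₁ - F₂) 1) (G 1) + inner ℝ ((F₁ - F₂) 2) (G 2)) := by
  rw [PiLp.inner_apply, Fin.sum_univ_three]
  have h0 : forcing ν e V F₁ F₂ 0 = 0 := rfl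
  have h1 : forcing ν e V F₁ F₂ 1 = crossFlux Complex.reCLM e V F₁ F₂ - ν • (F₁ - F₂) 1 := rfl
  have h2 : forcing ν e V F₁ F₂ 2 = crossFlux Complex.imCLM e V F₁ F₂ - ν • (F₁ - F₂) 2 := rfl
  rw [h0, h1, h2, inner_zero_left, inner_sub_left, inner_sub_left, real_inner_smul_left,
    real_inner_smul_left]
  ring

theorem norm_forcing_le {ν : ℝ} (hν : 0 ≤ ν) (F₁ F₂ : Jet Ω) : ‖forcing ν e V F₁ F₂‖ ≤
    2 * (‖e (F₁ - F₂)‖ * (‖e F₁‖ + ‖e F₂‖) + 2 * ‖V‖ * ‖(F₁ - F₂) 0‖)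
      + ν * (‖(F₁ - F₂) 1‖ + ‖(F₁ - F₂) 2‖) := by
  have h0 : forcing ν e V F₁ F₂ 0 = 0 := rfl
  have h1 : ‖forcing ν e V F₁ F₂ 1‖ ≤ _ := norm_sub_le (crossFlux Complex.reCLM e V F₁ F₂) _
  have h2 : ‖forcing ν e V F₁ F₂ 2‖ ≤ _ := norm_sub_le (crossFlux Complex.imCLM e V F₁ F₂) _
  rw [norm_smul, Real.norm_of_nonneg hν] at h1 h2
  have h3 := norm_crossFlux_le (e := e) (V := V) Complex.reCLM_norm.le F₁ F₂
  have h4 := norm_crossFlux_le (e := e) (V := V) Complex.imCLM_norm.le F₁ F₂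
  have h5 : ‖forcing ν e V F₁ F₂‖ ≤ ‖forcing ν e V F₁ F₂ 1‖ + ‖forcing ν e V F₁ F₂ 2‖ := by
    rw [PiLp.norm_eq_of_L2, Fin.sum_univ_three, h0, norm_zero]
    refine Real.sqrt_le_iff.2 ⟨by positivity, ?_⟩
    nlinarith [norm_nonneg (forcing ν e V F₁ F₂ 1), norm_nonneg (forcing ν e V F₁ F₂ 2)]
  linarith

/-- The difference of the momentum fluxes of two solutions, as a pairing of jets. -/
theorem momentumFlux_sub_eq_inner_forcing (hv : MemLp v ⊤ (volume.restrict Ω))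
    (hV : V =ᵐ[volume.restrict Ω] v) (ν : ℝ) {F₁ F₂ : Jet Ω}
    (he₁ : e F₁ =ᵐ[volume.restrict Ω] F₁ 0) (he₂ : e F₂ =ᵐ[volume.restrict Ω] F₂ 0)
    (h₁ : F₁ ∈ sobolevH1 Ω) (h₂ : F₂ ∈ sobolevH1 Ω) {u₁ u₂ : ℂ → ℂ}
    (hu₁ : F₁ 0 =ᵐ[volume.restrict Ω] fun x => u₁ x - v x)
    (hu₂ : F₂ 0 =ᵐ[volume.restrict Ω] fun x => u₂ x - v x)
    (hφ : IsTestFunction Ω φ) {J : Jet Ω} (hJ : IsJetOf Ω φ J) :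
    momentumFlux Ω ν φ u₁ - momentumFlux Ω ν φ u₂ = inner ℝ (forcing ν e V F₁ F₂) J := by
  obtain ⟨a, b, -, -, hab⟩ := exists_continuous_pairings hv hφ ν
  obtain ⟨-, i₁, -, -⟩ := hab _ _ hu₁
  obtain ⟨-, i₂, -, -⟩ := hab _ _ hu₂
  obtain ⟨hJ0, hJ1, hJ2⟩ := hJ
  set P := (((hφ.fderiv_apply 1).fderiv_apply 1).memLp (Ω := Ω) 2).toLp _ with hP
  set Q := (((hφ.fderiv_apply Complex.I).fderiv_apply Complex.I).memLp (Ω := Ω) 2).toLp _ with hQ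
  have hPc := (((hφ.fderiv_apply 1).fderiv_apply 1).memLp (Ω := Ω) 2).coeFn_toLp
  have hQc := (((hφ.fderiv_apply Complex.I).fderiv_apply Complex.I).memLp (Ω := Ω) 2).coeFn_toLp
  -- One derivative moves from `∂₁∂₁φ` onto the field; this turns the Laplacian term into `-ν ⟨∇w,
  -- ∇φ⟩`.
  have hPF : ∀ F ∈ sobolevH1 Ω, (inner ℝ (F 0) P : ℝ) = - inner ℝ (F 1) (J 1) := by
    intro F hF
    have h := hF.1.integral_inner_fderiv (hφ.fderiv_apply 1)
    rw [L2.inner_def, L2.inner_def]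
    refine Eq.trans (integral_congr_ae ?_) (h.trans (congrArg Neg.neg (integral_congr_ae ?_)))
    · filter_upwards [hPc] with x hx
      rw [hP, hx]
    · filter_upwards [hJ1] with x hx
      rw [hx]
  have hQF : ∀ F ∈ sobolevH1 Ω, (inner ℝ (F 0) Q : ℝ) = - inner ℝ (F 2) (J 2) := by
    intro F hF
    have h := hF.2.integral_inner_fderiv (hφ.fderiv_apply Complex.I)
    rw [L2.inner_def, L2.inner_def]
    refine Eq.trans (integral_congr_ae ?_) (h.trans (congrArg Neg.neg (integral_congr_ae ?_)))
    · filter_upwards [hQc] with x hx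
      rw [hQ, hx]
    · filter_upwards [hJ2] with x hx
      rw [hx]
  -- In the coordinates `Dφ(u) = Re u · ∂₁φ + Im u · ∂₂φ`, the difference of the convective terms is
  -- the pairing of `w ⊗ u₁ + u₂ ⊗ w` with `∇φ`. In the viscous term `v` cancels.
  set g₁ := crossFlux Complex.reCLM e V F₁ F₂ with hg₁
  set g₂ := crossFlux Complex.imCLM e V F₁ F₂ with hg₂
  have hpt : (fun x => ((inner ℝ (fderiv ℝ φ x (u₁ x)) (u₁ x) : ℝ)
        + ν * inner ℝ (u₁ x) (Laplacian.laplacian φ x))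
      - ((inner ℝ (fderiv ℝ φ x (u₂ x)) (u₂ x) : ℝ)
        + ν * inner ℝ (u₂ x) (Laplacian.laplacian φ x))) =ᵐ[volume.restrict Ω]
      fun x => ((inner ℝ (g₁ x) (J 1 x) : ℝ) + inner ℝ (g₂ x) (J 2 x))
        + ν * (inner ℝ ((F₁ 0 - F₂ 0 : L2 Ω) x) ((P + Q : L2 Ω) x)) := by
    filter_upwards [hu₁, hu₂, hJ1, hJ2, hPc, hQc, Lp.coeFn_sub (F₁ 0) (F₂ 0), Lp.coeFn_add P Q,
      coeFn_crossFlux (L := Complex.reCLM) he₁ he₂ hV,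
      coeFn_crossFlux (L := Complex.imCLM) he₁ he₂ hV] with x a1 a2 a3 a4 a5 a6 a7 a8 a9 b1
    have hD : ∀ z : ℂ, fderiv ℝ φ x z = z.re • fderiv ℝ φ x 1 + z.im • fderiv ℝ φ x Complex.I := by
      intro z
      rw [← map_smul, ← map_smul, ← map_add]
      congr 1
      apply Complex.ext <;> simp
    rw [hg₁, hg₂, a9, b1, a3, a4, a7, a8, Pi.sub_apply, Pi.add_apply, hP, hQ, a5, a6, a1, a2,
      laplacian_eq_fderiv_fderiv hφ.contDiff, hD (u₁ x), hD (u₂ x)]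
    simp only [Complex.reCLM_apply, Complex.imCLM_apply, sub_add_cancel, sub_sub_sub_cancel_right,
      Complex.sub_re, Complex.sub_im, inner_add_left, inner_add_right, inner_sub_left,
      inner_smul_left, sub_smul, smul_sub, conj_trivial]
    simp only [real_inner_comm _ (u₁ x), real_inner_comm _ (u₂ x)]
    ring
  have j1 := L2.integrable_inner (𝕜 := ℝ) g₁ (J 1)
  have j2 := L2.integrable_inner (𝕜 := ℝ) g₂ (J 2)
  have j3 := L2.integrable_inner (𝕜 := ℝ) (F₁ 0 - F₂ 0) (P + Q)
  have j12 : Integrable (fun x => (inner ℝ (g₁ x) (J 1 x) : ℝ) + inner ℝ (g₂ x) (J 2 x))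
      (volume.restrict Ω) := j1.add j2
  rw [momentumFlux, momentumFlux, ← integral_sub i₁ i₂, integral_congr_ae hpt,
    integral_add j12 (j3.const_mul ν), integral_add j1 j2, integral_const_mul,
    ← L2.inner_def, ← L2.inner_def, ← L2.inner_def, inner_forcing, inner_sub_left, inner_add_right,
    inner_add_right, hPF _ h₁, hPF _ h₂, hQF _ h₁, hQF _ h₂, PiLp.sub_apply, PiLp.sub_apply,
    inner_sub_left, inner_sub_left]
  ring

theorem exists_isJetOf (hφ : IsTestFunction Ω φ) : ∃ J : Jet Ω, IsJetOf Ω φ J := by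
  have h0 := hφ.memLp 2
  have h1 := (hφ.fderiv_apply 1).memLp 2
  have h2 := (hφ.fderiv_apply Complex.I).memLp 2
  exact ⟨WithLp.toLp 2 ![h0.toLp _, h1.toLp _, h2.toLp _], h0.coeFn_toLp, h1.coeFn_toLp,
    h2.coeFn_toLp⟩

end Flux

/-! ### Absorption into the viscosity and growth of the forcing. -/

section Estimates

/-- Three uses of Young's inequality, spending `ν/4`, `ν/4` and `ν/2` of the available `ν b²`. In
the application `E = ‖w‖₄`, `a = ‖w‖₂`, `b = ‖∂₁w‖₂ + ‖∂₂w‖₂`, `A` is the sum of the `L⁴` norms of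
the two solutions minus `v`, and `V` is the sup norm of `v`. -/
theorem absorb_le {ν C E A a b V : ℝ} (hν : 0 < ν)
    (hE : E ^ 2 ≤ C * (a * b)) :
    2 * ((E * A + 2 * V * a) * b) - ν * b ^ 2 ≤
      (16 * C ^ 2 / ν ^ 3 * A ^ 4 + 8 * V ^ 2 / ν) * a ^ 2 := by
  have h1 : 2 * (E * A * b) ≤ ν / 4 * b ^ 2 + 4 / ν * (E ^ 2 * A ^ 2) := by
    have h : ν / 4 * b ^ 2 + 4 / ν * (E ^ 2 * A ^ 2) - 2 * (E * A * b) =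
        (ν * b - 4 * (E * A)) ^ 2 / (4 * ν) := by field_simp; ring
    have : 0 ≤ (ν * b - 4 * (E * A)) ^ 2 / (4 * ν) := by positivity
    linarith
  have h2 : 4 / ν * (E ^ 2 * A ^ 2) ≤ 4 / ν * (C * (a * b) * A ^ 2) := by gcongr
  have h3 : 4 / ν * (C * (a * b) * A ^ 2) ≤
      ν / 4 * b ^ 2 + 16 * C ^ 2 / ν ^ 3 * A ^ 4 * a ^ 2 := by
    have h : ν / 4 * b ^ 2 + 16 * C ^ 2 / ν ^ 3 * A ^ 4 * a ^ 2 - 4 / ν * (C * (a * b) * A ^ 2) =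
        (ν ^ 2 * b - 8 * C * A ^ 2 * a) ^ 2 / (4 * ν ^ 3) := by field_simp; ring
    have : 0 ≤ (ν ^ 2 * b - 8 * C * A ^ 2 * a) ^ 2 / (4 * ν ^ 3) := by positivity
    linarith
  have h4 : 4 * V * a * b ≤ ν / 2 * b ^ 2 + 8 * V ^ 2 / ν * a ^ 2 := by
    have h : ν / 2 * b ^ 2 + 8 * V ^ 2 / ν * a ^ 2 - 4 * V * a * b =
        (ν * b - 4 * V * a) ^ 2 / (2 * ν) := by field_simp; ring
    have : 0 ≤ (ν * b - 4 * V * a) ^ 2 / (2 * ν) := by positivity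
    linarith
  linarith

variable {Ω : Set ℂ} {e : Jet Ω →L[ℝ] Lp ℂ 4 (volume.restrict Ω)} {V : Lp ℂ ⊤ (volume.restrict Ω)}

theorem two_mul_inner_forcing_le {ν C : ℝ} (hν : 0 < ν) {F₁ F₂ : Jet Ω}
    (he : ‖e (F₁ - F₂)‖ ^ 2 ≤ C * (‖(F₁ - F₂) 0‖ * (‖(F₁ - F₂) 1‖ + ‖(F₁ - F₂) 2‖))) :
    2 * (inner ℝ (forcing ν e V F₁ F₂) (F₁ - F₂) : ℝ) ≤
      (16 * C ^ 2 / ν ^ 3 * (‖e F₁‖ + ‖e F₂‖) ^ 4 + 8 * ‖V‖ ^ 2 / ν) * ‖(F₁ - F₂) 0‖ ^ 2 := by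
  rw [inner_forcing, real_inner_self_eq_norm_sq, real_inner_self_eq_norm_sq]
  set W := F₁ - F₂ with hW
  have h3 := norm_crossFlux_le (e := e) (V := V) Complex.reCLM_norm.le F₁ F₂
  have h4 := norm_crossFlux_le (e := e) (V := V) Complex.imCLM_norm.le F₁ F₂
  have h5 := (real_inner_le_norm (crossFlux Complex.reCLM e V F₁ F₂) (W 1)).trans
    (mul_le_mul_of_nonneg_right h3 (norm_nonneg _))
  have h6 := (real_inner_le_norm (crossFlux Complex.imCLM e V F₁ F₂) (W 2)).trans
    (mul_le_mul_of_nonneg_right h4 (norm_nonneg _))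
  have h7 := absorb_le (A := ‖e F₁‖ + ‖e F₂‖) (V := ‖V‖) hν he
  refine le_trans ?_ h7
  -- The factor `2` from differentiating `‖w‖²` is used up here, where the squared sum of the norms
  -- is bounded by the dissipation.
  have h8 : ν * (‖W 1‖ + ‖W 2‖) ^ 2 ≤ 2 * (ν * (‖W 1‖ ^ 2 + ‖W 2‖ ^ 2)) := by
    nlinarith [mul_nonneg hν.le (sq_nonneg (‖W 1‖ - ‖W 2‖))]
  linarith

theorem norm_sq_embedding_le {C m : ℝ} (hC : 0 ≤ C) {F : Jet Ω} (hm : ‖F 0‖ ≤ m)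
    (he : ‖e F‖ ^ 2 ≤ C * (‖F 0‖ * (‖F 1‖ + ‖F 2‖))) : ‖e F‖ ^ 2 ≤ 2 * C * m * ‖F‖ := by
  have hi : ∀ i, ‖F i‖ ≤ ‖F‖ := fun i => PiLp.norm_apply_le F i
  have hm0 : 0 ≤ m := (norm_nonneg _).trans hm
  calc ‖e F‖ ^ 2 ≤ C * (m * (‖F‖ + ‖F‖)) := he.trans (by gcongr; exacts [hi 1, hi 2])
    _ = _ := by ring

/-- The flux is quadratic, but for fields bounded in `L²` a product of two `L⁴` norms costs only one
power of the `H¹` norm. Linear growth is what puts the forcing in `L²` in time. -/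
theorem norm_forcing_le_mul {ν C m : ℝ} (hν : 0 ≤ ν) (hC : 0 ≤ C) {F₁ F₂ : Jet Ω}
    (hm₁ : ‖F₁ 0‖ ≤ m) (hm₂ : ‖F₂ 0‖ ≤ m)
    (he₁ : ‖e F₁‖ ^ 2 ≤ C * (‖F₁ 0‖ * (‖F₁ 1‖ + ‖F₁ 2‖)))
    (he₂ : ‖e F₂‖ ^ 2 ≤ C * (‖F₂ 0‖ * (‖F₂ 1‖ + ‖F₂ 2‖))) :
    ‖forcing ν e V F₁ F₂‖ ≤ (8 * C * m + 4 * ‖V‖ + 2 * ν) * (‖F₁‖ + ‖F₂‖) := by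
  have h1 := norm_sq_embedding_le hC hm₁ he₁
  have h2 := norm_sq_embedding_le hC hm₂ he₂
  have h3 : ‖e (F₁ - F₂)‖ ≤ ‖e F₁‖ + ‖e F₂‖ := by rw [map_sub]; exact norm_sub_le _ _
  have hi : ∀ i, ‖(F₁ - F₂) i‖ ≤ ‖F₁‖ + ‖F₂‖ := fun i =>
    (PiLp.norm_apply_le (F₁ - F₂) i).trans (norm_sub_le _ _)
  have h4 := norm_forcing_le (e := e) (V := V) hν F₁ F₂
  have h5 : ‖e (F₁ - F₂)‖ * (‖e F₁‖ + ‖e F₂‖) ≤ 4 * C * m * (‖F₁‖ + ‖F₂‖) := by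
    have := mul_le_mul_of_nonneg_right h3 (add_nonneg (norm_nonneg (e F₁)) (norm_nonneg (e F₂)))
    nlinarith [sq_nonneg (‖e F₁‖ - ‖e F₂‖)]
  have h6 := mul_le_mul_of_nonneg_left (hi 0) (norm_nonneg V)
  have h7 := mul_le_mul_of_nonneg_left (add_le_add (hi 1) (hi 2)) hν
  linarith

end Estimates

/-! ### The equation for the difference and the Grönwall argument. -/

section Uniqueness

variable {Ω : Set ℂ} {v : ℂ → ℂ}

theorem ae_restrict_Ioc_of_ae_restrict_Ioi {P : ℝ → Prop} (τ : ℝ)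
    (h : ∀ᵐ s ∂volume.restrict (Ioi (0 : ℝ)), P s) : ∀ᵐ s ∂volume.restrict (Ioc 0 τ), P s :=
  ae_restrict_of_ae_restrict_of_subset (fun _ hs => hs.1) h

/-- The integral form of the equation for the difference of two solutions. -/
theorem inner_sub_eq_inner_integral_forcing {ν : ℝ} {u₀ : ℂ → ℂ} {u₁ u₂ : ℝ → ℂ → ℂ}
    (hu₁ : IsWeakSolution Ω ν v u₀ u₁) (hu₂ : IsWeakSolution Ω ν v u₀ u₂)
    (hv : MemLp v ⊤ (volume.restrict Ω)) {V : Lp ℂ ⊤ (volume.restrict Ω)}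
    (hV : V =ᵐ[volume.restrict Ω] v)
    {w₁ w₂ : ℝ → L2 Ω} (hw₁ : ContinuousOn w₁ (Ici 0)) (hw₂ : ContinuousOn w₂ (Ici 0))
    (hwu₁ : ∀ t, 0 ≤ t → w₁ t =ᵐ[volume.restrict Ω] fun x => u₁ t x - v x)
    (hwu₂ : ∀ t, 0 ≤ t → w₂ t =ᵐ[volume.restrict Ω] fun x => u₂ t x - v x)
    {W₁ W₂ : ℝ → Jet Ω}
    (hW₁ : ∀ᵐ s ∂volume.restrict (Ioi (0 : ℝ)), W₁ s ∈ spaceV Ω ∧ W₁ s 0 = w₁ s)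
    (hW₂ : ∀ᵐ s ∂volume.restrict (Ioi (0 : ℝ)), W₂ s ∈ spaceV Ω ∧ W₂ s 0 = w₂ s)
    {e : Jet Ω →L[ℝ] Lp ℂ 4 (volume.restrict Ω)}
    (he : ∀ F ∈ (testJets Ω).topologicalClosure, e F =ᵐ[volume.restrict Ω] F 0)
    {t : ℝ} (ht : 0 ≤ t)
    (hp : IntegrableOn (fun s => forcing ν e V (W₁ s) (W₂ s)) (Ioc 0 t))
    {φ : ℂ → ℂ} (hφ : φ ∈ solenoidalTest Ω) {f : L2 Ω} (hf : f =ᵐ[volume.restrict Ω] φ)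
    {J : Jet Ω} (hJ : IsJetOf Ω φ J) :
    (inner ℝ (w₁ t - w₂ t) f : ℝ) =
      inner ℝ (∫ s in (0 : ℝ)..t, forcing ν e V (W₁ s) (W₂ s)) J := by
  obtain ⟨c₁, h₁⟩ := hu₁.pairing_eq hv hw₁ hwu₁ hφ ht
  obtain ⟨c₂, h₂⟩ := hu₂.pairing_eq hv hw₂ hwu₂ hφ ht
  obtain ⟨a, b, -, -, hab⟩ := exists_continuous_pairings hv hφ.1 ν
  have i₁ := (hab _ _ (hwu₁ t ht)).1
  have i₂ := (hab _ _ (hwu₂ t ht)).1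
  have e1 : (inner ℝ (w₁ t - w₂ t) f : ℝ) =
      (∫ x in Ω, (inner ℝ (u₁ t x) (φ x) : ℝ)) - ∫ x in Ω, (inner ℝ (u₂ t x) (φ x) : ℝ) := by
    rw [← integral_sub i₁ i₂, L2.inner_def]
    refine integral_congr_ae ?_
    filter_upwards [hwu₁ t ht, hwu₂ t ht, hf, Lp.coeFn_sub (w₁ t) (w₂ t)] with x a1 a2 a3 a4
    rw [a4, Pi.sub_apply, a1, a2, a3, sub_sub_sub_cancel_right, inner_sub_left]
  have hsub : uIcc 0 t ⊆ Ici 0 := by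
    rw [uIcc_of_le ht]; exact Icc_subset_Ici_self
  rw [e1, h₁, h₂, add_sub_add_left_eq_sub, ← intervalIntegral.integral_sub
    (c₁.mono hsub).intervalIntegrable (c₂.mono hsub).intervalIntegrable, real_inner_comm,
    intervalIntegral.integral_of_le ht, intervalIntegral.integral_of_le ht, ← integral_inner hp]
  refine integral_congr_ae ?_
  filter_upwards [ae_restrict_Ioc_of_ae_restrict_Ioi t hW₁, ae_restrict_Ioc_of_ae_restrict_Ioi t hW₂,
    ae_restrict_mem measurableSet_Ioc] with s a1 a2 hs
  rw [real_inner_comm]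
  refine momentumFlux_sub_eq_inner_forcing hv hV ν (he _ (spaceV_subset a1.1))
    (he _ (spaceV_subset a2.1)) a1.1.1 a2.1.1 ?_ ?_ hφ.1 hJ
  · rw [a1.2]; exact hwu₁ s hs.1.le
  · rw [a2.2]; exact hwu₂ s hs.1.le

variable {e : Jet Ω →L[ℝ] Lp ℂ 4 (volume.restrict Ω)} {V : Lp ℂ ⊤ (volume.restrict Ω)}

theorem memLp_forcing {ν C m τ : ℝ} (hν : 0 ≤ ν) (hC : 0 ≤ C)
    (he : ∀ F ∈ (testJets Ω).topologicalClosure, ‖e F‖ ^ 2 ≤ C * (‖F 0‖ * (‖F 1‖ + ‖F 2‖)))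
    {W₁ W₂ : ℝ → Jet Ω} (hWm₁ : MemLp W₁ 2 (volume.restrict (Ioc 0 τ)))
    (hWm₂ : MemLp W₂ 2 (volume.restrict (Ioc 0 τ)))
    (hW₁ : ∀ᵐ s ∂volume.restrict (Ioc 0 τ), W₁ s ∈ spaceV Ω ∧ ‖W₁ s 0‖ ≤ m)
    (hW₂ : ∀ᵐ s ∂volume.restrict (Ioc 0 τ), W₂ s ∈ spaceV Ω ∧ ‖W₂ s 0‖ ≤ m) :
    MemLp (fun s => forcing ν e V (W₁ s) (W₂ s)) 2 (volume.restrict (Ioc 0 τ)) := by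
  have hdom : MemLp (fun s => ‖W₁ s‖ + ‖W₂ s‖) 2 (volume.restrict (Ioc 0 τ)) :=
    hWm₁.norm.add hWm₂.norm
  have hmeas : AEStronglyMeasurable (fun s => forcing ν e V (W₁ s) (W₂ s))
      (volume.restrict (Ioc 0 τ)) := by
    have hc := continuous_forcing (e := e) (V := V) ν
    have h := Continuous.comp_aestronglyMeasurable₂ (g := forcing ν e V) hc hWm₁.1 hWm₂.1
    exact h
  refine hdom.of_le_mul (c := 8 * C * m + 4 * ‖V‖ + 2 * ν) hmeas ?_
  filter_upwards [hW₁, hW₂] with s a1 a2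
  rw [Real.norm_of_nonneg (add_nonneg (norm_nonneg (W₁ s)) (norm_nonneg (W₂ s)))]
  exact norm_forcing_le_mul hν hC a1.2 a2.2 (he _ (spaceV_subset a1.1)) (he _ (spaceV_subset a2.1))

/-- Squaring Ladyzhenskaya's inequality gives `‖W‖₄⁴ ≤ (2Cm)² ‖W‖²` with the `H¹` norm on the right,
which is integrable in time. -/
theorem memLp_four_embedding {C m τ : ℝ} (hC : 0 ≤ C)
    (he : ∀ F ∈ (testJets Ω).topologicalClosure, ‖e F‖ ^ 2 ≤ C * (‖F 0‖ * (‖F 1‖ + ‖F 2‖)))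
    {W : ℝ → Jet Ω} (hWm : MemLp W 2 (volume.restrict (Ioc 0 τ)))
    (hW : ∀ᵐ s ∂volume.restrict (Ioc 0 τ), W s ∈ spaceV Ω ∧ ‖W s 0‖ ≤ m) :
    MemLp (fun s => ‖e (W s)‖) 4 (volume.restrict (Ioc 0 τ)) := by
  have hmeas : AEStronglyMeasurable (fun s => e (W s)) (volume.restrict (Ioc 0 τ)) :=
    e.continuous.comp_aestronglyMeasurable hWm.1
  refine (integrable_norm_rpow_iff hmeas.norm (by norm_num) (by norm_num)).1 ?_
  have hdom : Integrable (fun s => (2 * C * m) ^ 2 * ‖W s‖ ^ 2) (volume.restrict (Ioc 0 τ)) :=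
    (hWm.integrable_norm_pow (by norm_num)).const_mul _
  have hpow : AEStronglyMeasurable (fun s => ‖e (W s)‖ ^ 4) (volume.restrict (Ioc 0 τ)) :=
    hmeas.norm.pow 4
  refine hdom.mono' (by simpa using hpow) ?_
  filter_upwards [hW] with s a1
  have h1 := norm_sq_embedding_le hC a1.2 (he _ (spaceV_subset a1.1))
  have h2 := pow_le_pow_left₀ (sq_nonneg _) h1 2
  simp only [norm_norm, ENNReal.toReal_ofNat, Real.rpow_ofNat, norm_pow]
  calc ‖e (W s)‖ ^ 4 = (‖e (W s)‖ ^ 2) ^ 2 := by ring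
    _ ≤ _ := h2
    _ = _ := by ring

/-- The Grönwall coefficient. -/
noncomputable def energyRate (ν C : ℝ) (e : Jet Ω →L[ℝ] Lp ℂ 4 (volume.restrict Ω))
    (V : Lp ℂ ⊤ (volume.restrict Ω)) (F₁ F₂ : Jet Ω) : ℝ :=
  16 * C ^ 2 / ν ^ 3 * (‖e F₁‖ + ‖e F₂‖) ^ 4 + 8 * ‖V‖ ^ 2 / ν

theorem integrableOn_energyRate {ν C m τ : ℝ} (hC : 0 ≤ C)
    (he : ∀ F ∈ (testJets Ω).topologicalClosure, ‖e F‖ ^ 2 ≤ C * (‖F 0‖ * (‖F 1‖ + ‖F 2‖)))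
    {W₁ W₂ : ℝ → Jet Ω} (hWm₁ : MemLp W₁ 2 (volume.restrict (Ioc 0 τ)))
    (hWm₂ : MemLp W₂ 2 (volume.restrict (Ioc 0 τ)))
    (hW₁ : ∀ᵐ s ∂volume.restrict (Ioc 0 τ), W₁ s ∈ spaceV Ω ∧ ‖W₁ s 0‖ ≤ m)
    (hW₂ : ∀ᵐ s ∂volume.restrict (Ioc 0 τ), W₂ s ∈ spaceV Ω ∧ ‖W₂ s 0‖ ≤ m) :
    IntegrableOn (fun s => energyRate ν C e V (W₁ s) (W₂ s)) (Icc 0 τ) := by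
  rw [integrableOn_Icc_iff_integrableOn_Ioc]
  have h4 := ((memLp_four_embedding hC he hWm₁ hW₁).add
    (memLp_four_embedding hC he hWm₂ hW₂)).integrable_norm_pow (p := 4) (by norm_num)
  refine Integrable.add ((h4.congr (Eventually.of_forall fun s => ?_)).const_mul _)
    (integrable_const _)
  simp only [Pi.add_apply]
  rw [Real.norm_of_nonneg (by positivity)]

/-- Two curves in `𝓗` whose difference solves the linear equation with forcing `p` tested with
divergence-free fields agree initially, and may be tested with jets in `𝓥`. -/
theorem eq_zero_and_inner_eq_of_test {w₁ w₂ : ℝ → L2 Ω} {p : ℝ → Jet Ω}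
    (hwH₁ : w₁ 0 ∈ spaceH Ω) (hwH₂ : w₂ 0 ∈ spaceH Ω)
    (hweak : ∀ t, 0 ≤ t → ∀ φ ∈ solenoidalTest Ω, ∀ f : L2 Ω, f =ᵐ[volume.restrict Ω] φ →
      ∀ J : Jet Ω, IsJetOf Ω φ J →
        (inner ℝ (w₁ t - w₂ t) f : ℝ) = inner ℝ (∫ s in (0 : ℝ)..t, p s) J) :
    w₁ 0 - w₂ 0 = 0 ∧ ∀ t, 0 ≤ t → ∀ F ∈ (testJets Ω).topologicalClosure,
      (inner ℝ (w₁ t - w₂ t) (F 0) : ℝ) = inner ℝ (∫ s in (0 : ℝ)..t, p s) F := by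
  constructor
  -- At time `0` the integral is empty, so the difference is orthogonal to the test fields, hence to
  -- their closure, which contains both initial values.
  · have h : ∀ f ∈ spaceH Ω, (inner ℝ (w₁ 0 - w₂ 0) f : ℝ) = 0 := by
      intro f hf
      refine closure_minimal (s := {f : L2 Ω | ∃ φ ∈ solenoidalTest Ω, f =ᵐ[volume.restrict Ω] φ})
        (t := {f : L2 Ω | (inner ℝ (w₁ 0 - w₂ 0) f : ℝ) = 0}) ?_ ?_ hf
      · rintro f ⟨φ, hφ, hfφ⟩
        obtain ⟨J, hJ⟩ := exists_isJetOf hφ.1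
        change (inner ℝ (w₁ 0 - w₂ 0) f : ℝ) = 0
        rw [hweak 0 le_rfl φ hφ f hfφ J hJ, intervalIntegral.integral_same, inner_zero_left]
      · exact isClosed_eq (continuous_const.inner continuous_id) continuous_const
    refine (inner_self_eq_zero (𝕜 := ℝ)).1 ?_
    rw [inner_sub_right, h _ hwH₁, h _ hwH₂, sub_zero]
  · intro t ht F hF
    refine closure_minimal (s := (testJets Ω : Set (Jet Ω)))
      (t := {F : Jet Ω | (inner ℝ (w₁ t - w₂ t) (F 0) : ℝ) =
        inner ℝ (∫ s in (0 : ℝ)..t, p s) F}) ?_ ?_ hF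
    · rintro F ⟨φ, hφ, hJ⟩
      exact hweak t ht φ hφ _ hJ.1 F hJ
    · exact isClosed_eq (continuous_const.inner (PiLp.continuous_apply 2 _ 0))
        (continuous_const.inner continuous_id)

/-- Uniqueness of weak solutions relative to an arbitrary bounded background field. -/
theorem IsWeakSolution.ae_eq {ν : ℝ} (hν : 0 < ν) {u₀ : ℂ → ℂ} {u₁ u₂ : ℝ → ℂ → ℂ}
    (hu₁ : IsWeakSolution Ω ν v u₀ u₁) (hu₂ : IsWeakSolution Ω ν v u₀ u₂)
    (hv : MemLp v ⊤ (volume.restrict Ω)) {t : ℝ} (ht : 0 ≤ t) :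
    u₁ t =ᵐ[volume.restrict Ω] u₂ t := by
  obtain ⟨w₁, ⟨hw₁, hwH₁⟩, ⟨W₁, hWm₁, hW₁⟩, hwu₁⟩ := hu₁.regularity
  obtain ⟨w₂, ⟨hw₂, hwH₂⟩, ⟨W₂, hWm₂, hW₂⟩, hwu₂⟩ := hu₂.regularity
  obtain ⟨C, e, hC, he⟩ := exists_embedding_L4 Ω
  have he2 : ∀ F ∈ (testJets Ω).topologicalClosure, ‖e F‖ ^ 2 ≤ C * (‖F 0‖ * (‖F 1‖ + ‖F 2‖)) :=
    fun F hF => (he F hF).2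
  obtain ⟨V, hV⟩ : ∃ V : Lp ℂ ⊤ (volume.restrict Ω), V =ᵐ[volume.restrict Ω] v :=
    ⟨hv.toLp v, hv.coeFn_toLp⟩
  have hwc : ContinuousOn (fun t => w₁ t - w₂ t) (Ici 0) := hw₁.sub hw₂
  have hbd : ∀ τ : ℝ, ∃ m : ℝ,
      (∀ᵐ s ∂volume.restrict (Ioc 0 τ), W₁ s ∈ spaceV Ω ∧ ‖W₁ s 0‖ ≤ m) ∧
      ∀ᵐ s ∂volume.restrict (Ioc 0 τ), W₂ s ∈ spaceV Ω ∧ ‖W₂ s 0‖ ≤ m := by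
    intro τ
    obtain ⟨m₁, h₁⟩ := isCompact_Icc.exists_bound_of_continuousOn
      (hw₁.mono fun s (hs : s ∈ Icc 0 τ) => hs.1)
    obtain ⟨m₂, h₂⟩ := isCompact_Icc.exists_bound_of_continuousOn
      (hw₂.mono fun s (hs : s ∈ Icc 0 τ) => hs.1)
    refine ⟨max m₁ m₂, ?_, ?_⟩
    · filter_upwards [ae_restrict_Ioc_of_ae_restrict_Ioi τ hW₁, ae_restrict_mem measurableSet_Ioc]
        with s a1 hs
      exact ⟨a1.1, a1.2 ▸ (h₁ s ⟨hs.1.le, hs.2⟩).trans (le_max_left _ _)⟩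
    · filter_upwards [ae_restrict_Ioc_of_ae_restrict_Ioi τ hW₂, ae_restrict_mem measurableSet_Ioc]
        with s a1 hs
      exact ⟨a1.1, a1.2 ▸ (h₂ s ⟨hs.1.le, hs.2⟩).trans (le_max_right _ _)⟩
  obtain ⟨p, hp⟩ : ∃ p : ℝ → Jet Ω, p = fun s => forcing ν e V (W₁ s) (W₂ s) := ⟨_, rfl⟩
  have hpm : ∀ τ, 0 < τ → MemLp p 2 (volume.restrict (Ioc 0 τ)) := by
    intro τ hτ
    obtain ⟨m, hm₁, hm₂⟩ := hbd τ
    rw [hp]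
    exact memLp_forcing hν.le hC he2 (hWm₁ τ hτ) (hWm₂ τ hτ) hm₁ hm₂
  have hpint : ∀ τ, 0 ≤ τ → IntegrableOn p (Ioc 0 τ) := by
    intro τ hτ
    rcases hτ.eq_or_lt with rfl | hτ
    · simp
    · exact (hpm τ hτ).integrable (by norm_num)
  have hweak : ∀ t, 0 ≤ t → ∀ φ ∈ solenoidalTest Ω, ∀ f : L2 Ω, f =ᵐ[volume.restrict Ω] φ →
      ∀ J : Jet Ω, IsJetOf Ω φ J →
        (inner ℝ (w₁ t - w₂ t) f : ℝ) = inner ℝ (∫ s in (0 : ℝ)..t, p s) J := by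
    intro t ht φ hφ f hf J hJ
    have hpi := hpint t ht
    rw [hp] at hpi ⊢
    exact inner_sub_eq_inner_integral_forcing hu₁ hu₂ hv hV hw₁ hw₂ hwu₁ hwu₂
      hW₁ hW₂ (fun F hF => (he F hF).1) ht hpi hφ hf hJ
  obtain ⟨hw0, hjet⟩ := eq_zero_and_inner_eq_of_test (hwH₁ 0 le_rfl) (hwH₂ 0 le_rfl) hweak
  have hqm : ∀ τ, 0 < τ → MemLp (fun s => W₁ s - W₂ s) 2 (volume.restrict (Ioc 0 τ)) :=
    fun τ hτ => (hWm₁ τ hτ).sub (hWm₂ τ hτ)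
  have hqV : ∀ᵐ s ∂volume.restrict (Ioi (0 : ℝ)),
      W₁ s - W₂ s ∈ (testJets Ω).topologicalClosure ∧ (W₁ s - W₂ s) 0 = w₁ s - w₂ s := by
    filter_upwards [hW₁, hW₂] with s a1 a2
    refine ⟨Submodule.sub_mem _ (spaceV_subset a1.1) (spaceV_subset a2.1), ?_⟩
    rw [PiLp.sub_apply, a1.2, a2.2]
  have henergy : ∀ t, 0 < t → ‖w₁ t - w₂ t‖ ^ 2 =
      2 * ∫ s in (0 : ℝ)..t, (inner ℝ (p s) (W₁ s - W₂ s) : ℝ) := by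
    intro t ht
    refine norm_sq_eq_two_mul_integral_inner hwc hw0 hpm hqm ?_ ht
    filter_upwards [hqV] with s hs r hr
    rw [← hs.2]
    exact hjet r hr _ hs.1
  have hKint : ∀ τ, 0 < τ → IntegrableOn (fun s => energyRate ν C e V (W₁ s) (W₂ s)) (Icc 0 τ) := by
    intro τ hτ
    obtain ⟨m, hm₁, hm₂⟩ := hbd τ
    exact integrableOn_energyRate hC he2 (hWm₁ τ hτ) (hWm₂ τ hτ) hm₁ hm₂
  have hE2 : ∀ τ, ContinuousOn (fun s => ‖w₁ s - w₂ s‖ ^ 2) (Icc 0 τ) := fun τ =>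
    (hwc.mono fun s hs => hs.1).norm.pow 2
  -- The horizon `t + 1` keeps the interval nondegenerate when `t = 0`.
  have hE := eq_zero_of_le_integral_mul (E := fun s => ‖w₁ s - w₂ s‖ ^ 2) (τ := t + 1)
    (hE2 _) (fun s _ => sq_nonneg _) (hKint _ (by linarith))
    (fun s => by unfold energyRate; positivity) ?_ t ⟨ht, by linarith⟩
  · have hwt : w₁ t = w₂ t := by simpa [sub_eq_zero] using hE
    have h2 := hwu₂ t ht
    rw [← hwt] at h2
    filter_upwards [hwu₁ t ht, h2] with x a1 a2
    simpa using a1.symm.trans a2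
  · intro r hr
    rcases hr.1.eq_or_lt with rfl | hr0
    · simp [hw0]
    · rw [henergy r hr0, ← intervalIntegral.integral_const_mul]
      have hpq : Integrable (fun s => (inner ℝ (p s) (W₁ s - W₂ s) : ℝ))
          (volume.restrict (Ioc 0 r)) := by
        refine ((hpm r hr0).norm.integrable_mul (hqm r hr0).norm).mono'
          ((hpm r hr0).1.inner (hqm r hr0).1) (Eventually.of_forall fun s => ?_)
        exact norm_inner_le_norm _ _
      have hKE : IntegrableOn (fun s => energyRate ν C e V (W₁ s) (W₂ s) * ‖w₁ s - w₂ s‖ ^ 2)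
          (Icc 0 r) := (hKint r hr0).mul_continuousOn (hE2 r) isCompact_Icc
      rw [intervalIntegral.integral_of_le hr0.le, intervalIntegral.integral_of_le hr0.le]
      refine integral_mono_ae (hpq.const_mul 2) (hKE.mono_set Ioc_subset_Icc_self) ?_
      filter_upwards [ae_restrict_Ioc_of_ae_restrict_Ioi r hqV] with s hs
      have h := two_mul_inner_forcing_le (V := V) hν (he2 _ hs.1)
      rw [← hs.2, hp]
      exact h

end Uniqueness

end ThinObstacle

/-! ### Application to the exterior of the arc. -/

theorem proposition5p1
    (γ : ℝ → ℂ) (hγ : ThinObstacle.IsC2JordanArc γ) (hγ0 : γ 0 = -1) (hγ1 : γ 1 = 1)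
    (hseg : ThinObstacle.IsFiniteUnionOfSegments (ThinObstacle.arc γ ∩ segment ℝ (-1) 1))
    (T : ℂ → ℂ)
    (hT : ThinObstacle.IsBiholomorphism T (ThinObstacle.arc γ)ᶜ {w : ℂ | 1 < ‖w‖})
    (Φ : ℝ → ℝ) (hΦ : ThinObstacle.IsCutoffProfile Φ) (lam : ℝ) (hlam : 2 ≤ lam)
    (ω₀ : ℂ → ℝ) (hω₀ : ThinObstacle.IsTestFunction (ThinObstacle.arc γ)ᶜ ω₀)
    (circ : ℝ) (ν : ℝ) (hν : 0 < ν)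
    (u₁ u₂ : ℝ → ℂ → ℂ)
    (h₁ : ThinObstacle.IsWeakSolution (ThinObstacle.arc γ)ᶜ ν
      (ThinObstacle.backgroundField T Φ lam (ThinObstacle.alpha circ ω₀))
      (ThinObstacle.initialVelocity (ThinObstacle.arc γ)ᶜ T ω₀ (ThinObstacle.alpha circ ω₀)) u₁)
    (h₂ : ThinObstacle.IsWeakSolution (ThinObstacle.arc γ)ᶜ ν
      (ThinObstacle.backgroundField T Φ lam (ThinObstacle.alpha circ ω₀))
      (ThinObstacle.initialVelocity (ThinObstacle.arc γ)ᶜ T ω₀ (ThinObstacle.alpha circ ω₀)) u₂) :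
    ∀ t : ℝ, 0 ≤ t → u₁ t =ᵐ[volume.restrict (ThinObstacle.arc γ)ᶜ] u₂ t := fun _ ht =>
  h₁.ae_eq hν h₂
    (ThinObstacle.memLp_top_backgroundField (ThinObstacle.isCompact_arc hγ) hT hΦ hlam _) ht
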